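/- **Theorem 3.1.** For a finite subset $A$ of an abelian group and $m\ge 1$ let $$E_{2m}(A)=\bigl|\{(a_1,\dots,a_{2m})\in A^{2m}: a_1+\dots+a_m=a_{m+1}+\dots+a_{2m}\}\bigr| .$$ Fix $\tau_0>0$. There is a function $f=f_{\tau_0}\colon(0,1)\to(0,\infty)$ with $f(\eta)\to0$ as $\eta\to0$ such that for all $K>0$ and $\sigma_0\in(0,1)$ there is a constant $C=C(\tau_0,\sigma_0,K)>0$ with the following property. Let $Z$ be an abelian group and let $\Delta\subseteq Z$ be a finite symmetric set ($\Delta=-\Delta$) of size $M$ such that $$K^{-1}M^{2+\tau_0}\le E_4(\Delta)\le K M^{2+\tau_0},\qquad E_8(\Delta)\le K M^{4+3\tau_0+\sigma_0},$$ and such that for every $a\in\Delta$ $$\bigl|\{(b,c,d)\in\Delta^3: a-b=c-d\}\bigr|\le K M^{1+\tau_0}.$$ Then there exist a real number $\alpha\ge0$ and finite symmetric sets $H,X\subseteq Z$ such that $$|H|\le C M^{\tau_0+\alpha+f(\sigma_0)},\qquad |X|\le C M^{1-\tau_0-2\alpha+f(\sigma_0)},\qquad |H-H|\le C|H|^{1+f(\sigma_0)},$$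 and $$|(X+H)\cap\Delta|\ge C^{-1}M^{1-\alpha-f(\sigma_0)} .$$ -/

import Mathlib

open scoped Pointwise

universe u

/-- The additive energy `E_{2m}(A)` (so the index here is half of the subscript): the number of
`2m`-tuples of elements of `A` with `a_1 + ⋯ + a_m = a_{m+1} + ⋯ + a_{2m}`. The tuple is given as
the pair of its two halves. -/
def energyTwoMul {Z : Type u} [AddCommGroup Z] [DecidableEq Z] (m : ℕ) (A : Finset Z) : ℕ :=
  (((Fintype.piFinset fun _ : Fin m => A) ×ˢ (Fintype.piFinset fun _ : Fin m => A)).filter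
    fun p => ∑ i, p.1 i = ∑ i, p.2 i).card

/-- The number of additive quadruples of `A` in which `a` occurs in the first position:
triples `(b, c, d)` in `A ^ 3` with `a - b = c - d`. -/
def quadruplesThrough {Z : Type u} [AddCommGroup Z] [DecidableEq Z] (A : Finset Z) (a : Z) : ℕ :=
  ((A ×ˢ A ×ˢ A).filter fun p => a - p.1 = p.2.1 - p.2.2).card

section

open Finset

variable {Z : Type u} [AddCommGroup Z] [DecidableEq Z]

/-! Write r(d) for `diffCount A d`, m = |A| and T = m^(1+τ₀). The hypotheses say that E_4 is about
mT, that each point lies in O(T) additive quadruples, and that E_8 is at most about m^σ₀ · mT³.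
Since E_4³ ≤ m² E_8, this is nearly the least possible E_8, and the proof exploits this
near-equality.

From energy to a dense graph. Choose a scale P whose differences, r(d) ≈ P, carry much of E_4 while
those with r(d) < P carry far less (`exists_critical_scale`). By Cauchy–Schwarz, pairs s, t of such
differences have many common base points o, with o, o + s, o + t all in A. The bound on E_8 shows
that pairs with s - t unpopular, or with fewer than ηP base points, contribute little
(`sq_energy_le_of_negligible`). Fixing a good t gives sets S of differences and Y of base points
whose graph {(s, o) : o + s ∈ A} has about T edges and is dense in S × Y (`exists_graph_of_energy`).

From the graph to almost periods. After regularising, each sum o + s is attained about equally often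
on a set C ⊆ A. Three-edge paths starting at edges with the same sum c have their ends, taken
relative to the starting edge, in one box of size comparable to |S||Y|, because few quadruples pass
through c. So many pairs of such edges share many ends, and their offsets form a set B of almost
periods of C with |B||C| at least about T (`exists_almost_periods_of_graph`).

From almost periods to structure. A Balog–Szemerédi–Gowers argument, again limited by the quadruple
count, gives H₀ ⊆ B with small difference set. Plünnecke–Ruzsa controls H = H₀ - H₀, and a covering
argument covers much of C by few translates of H (`exists_symmetric_cover_of_almost_periods`). With
|C| = m^(1-α), the sizes are |H| ≈ T/|C| and |X| ≲ |C|²/T.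

All losses are powers of one parameter L = O(m^δ), where δ can be made small once σ₀ is small
enough; f is then chosen nearly optimal for each σ₀. -/

/-! ### Difference counts, quadruples through a point, and energies. -/

/-- The number of ways to write `d` as a difference of two elements of `A`. -/
def diffCount (A : Finset Z) (d : Z) : ℕ := (A.filter fun a => a + d ∈ A).card

theorem diffCount_neg (A : Finset Z) (d : Z) : diffCount A (-d) = diffCount A d := by
  unfold diffCount
  refine Finset.card_nbij' (fun a => a - d) (fun a => a + d) ?_ ?_ ?_ ?_ <;>
    intro a <;> simp +contextual [← sub_eq_add_neg]

theorem diffCount_le_card (A : Finset Z) (d : Z) : diffCount A d ≤ A.card :=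
  card_filter_le _ _

theorem diffCount_mono {A B : Finset Z} (h : A ⊆ B) (d : Z) : diffCount A d ≤ diffCount B d := by
  apply card_le_card
  intro a
  simp only [mem_filter]
  exact fun ha => ⟨h ha.1, h ha.2⟩

theorem mem_sub_self_of_diffCount_pos {A : Finset Z} {d : Z} (h : 0 < diffCount A d) :
    d ∈ A - A := by
  obtain ⟨a, ha⟩ := card_pos.mp h
  rw [mem_filter] at ha
  exact mem_sub.mpr ⟨a + d, ha.2, a, ha.1, by abel⟩

theorem quadruplesThrough_eq_sum (A : Finset Z) (a : Z) :
    quadruplesThrough A a = ∑ b ∈ A, diffCount A (a - b) := by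
  unfold quadruplesThrough diffCount
  rw [← card_sigma]
  refine Finset.card_nbij' (fun p => ⟨p.1, p.2.2⟩) (fun p => (p.1, p.2 + (a - p.1), p.2))
    ?_ ?_ ?_ ?_
  · rintro ⟨b, c, d⟩
    simp only [coe_filter, mem_product, Set.mem_ofPred_eq, coe_sigma, Set.mem_sigma_iff, mem_coe]
    rintro ⟨⟨hb, hc, hd⟩, h⟩
    refine ⟨hb, hd, ?_⟩
    rw [h]; simpa using hc
  · rintro ⟨b, d⟩
    simp +contextual
  · rintro ⟨b, c, d⟩
    simp only [coe_filter, mem_product, Set.mem_ofPred_eq]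
    rintro ⟨-, h⟩
    simp [h]
  · rintro ⟨b, d⟩
    simp

/-- Each b = c + d with d ∈ U contributes r(c - b) = r(d) ≥ θ quadruples through c. This is how the
quadruple hypothesis enters everywhere: few popular differences start at a given point. -/
theorem card_mul_le_of_popular {A U : Finset Z} {c : Z} {θ W : ℝ}
    (hW : (quadruplesThrough A c : ℝ) ≤ W) (hU : ∀ d ∈ U, c + d ∈ A)
    (hθ : ∀ d ∈ U, θ ≤ (diffCount A d : ℝ)) : (U.card : ℝ) * θ ≤ W := by
  refine le_trans ?_ hW
  have h1 : (U.card : ℝ) * θ ≤ ∑ d ∈ U, (diffCount A d : ℝ) := by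
    rw [← nsmul_eq_mul]
    exact card_nsmul_le_sum _ _ _ hθ
  refine h1.trans ?_
  rw [quadruplesThrough_eq_sum]
  push_cast
  have h2 : ∑ d ∈ U, (diffCount A d : ℝ) =
      ∑ b ∈ U.map (addLeftEmbedding c), (diffCount A (c - b) : ℝ) := by
    rw [sum_map]
    refine sum_congr rfl fun d _ => ?_
    have : c - (addLeftEmbedding c) d = -d := by simp [addLeftEmbedding]
    rw [this, diffCount_neg]
  rw [h2]
  refine sum_le_sum_of_subset_of_nonneg ?_ fun _ _ _ => by positivity
  intro b hb
  rw [mem_map] at hb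
  obtain ⟨d, hd, rfl⟩ := hb
  simpa using hU d hd

theorem energyTwoMul_two_eq_sum (A : Finset Z) :
    energyTwoMul 2 A = ∑ d ∈ A - A, diffCount A d ^ 2 := by
  unfold energyTwoMul
  have h : ∀ d ∈ A - A, diffCount A d ^ 2 =
      ((A.filter fun a => a + d ∈ A) ×ˢ (A.filter fun a => a + d ∈ A)).card := by
    intro d _
    rw [card_product, sq]; rfl
  rw [sum_congr rfl h, ← card_sigma]
  refine Finset.card_nbij' (fun p => ⟨p.1 0 - p.2 1, p.2 1, p.1 1⟩)
    (fun q => (![q.2.1 + q.1, q.2.2], ![q.2.2 + q.1, q.2.1])) ?_ ?_ ?_ ?_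
  · rintro ⟨p, q⟩
    simp only [coe_filter, mem_product, Set.mem_ofPred_eq, coe_sigma, Set.mem_sigma_iff, mem_coe,
      Fintype.mem_piFinset, Fin.forall_fin_two, Fin.sum_univ_two, mem_filter]
    rintro ⟨⟨⟨h1, h2⟩, h3, h4⟩, h⟩
    have e : p 1 + (p 0 - q 1) = q 0 := by
      have : p 1 + (p 0 - q 1) = (p 0 + p 1) - q 1 := by abel
      rw [this, h]; abel
    exact ⟨sub_mem_sub h1 h4, ⟨h4, by simpa using h1⟩, h2, e ▸ h3⟩
  · rintro ⟨d, a, b⟩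
    simp only [coe_filter, mem_product, Set.mem_ofPred_eq, coe_sigma, Set.mem_sigma_iff, mem_coe,
      Fintype.mem_piFinset, Fin.forall_fin_two, Fin.sum_univ_two, mem_filter]
    rintro ⟨-, ⟨h1, h2⟩, h3, h4⟩
    simp only [Matrix.cons_val_zero, Matrix.cons_val_one]
    exact ⟨⟨⟨h2, h3⟩, h4, h1⟩, by abel⟩
  · rintro ⟨p, q⟩
    simp only [coe_filter, mem_product, Set.mem_ofPred_eq, Fin.sum_univ_two]
    rintro ⟨-, h⟩
    have e : p 1 + (p 0 - q 1) = q 0 := by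
      have : p 1 + (p 0 - q 1) = (p 0 + p 1) - q 1 := by abel
      rw [this, h]; abel
    ext i <;> fin_cases i <;> simp [e]
  · rintro ⟨d, a, b⟩
    simp

/-- The weighted additive energy of the difference counts is at most the eightfold energy. -/
theorem sum_diffCount_le_energyTwoMul_four (A D : Finset Z) :
    ∑ q ∈ ((D ×ˢ D) ×ˢ (D ×ˢ D)).filter (fun q => q.1.1 - q.1.2 = q.2.1 - q.2.2),
      (diffCount A q.1.1 * diffCount A q.1.2) * (diffCount A q.2.1 * diffCount A q.2.2)
      ≤ energyTwoMul 4 A := by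
  unfold energyTwoMul diffCount
  simp only [← card_product]
  rw [← card_sigma]
  refine Finset.card_le_card_of_injOn
    -- The relation s - s₀ = s' - s₀' reads s + s₀' = s' + s₀. Attaching the base points a, b, c, d
    -- gives (a + s) + (d + s₀') + c + b = (c + s') + (b + s₀) + a + d, with all eight terms in A.
    (fun x => (![x.2.1.1 + x.1.1.1, x.2.2.2 + x.1.2.2, x.2.2.1, x.2.1.2],
      ![x.2.2.1 + x.1.2.1, x.2.1.2 + x.1.1.2, x.2.1.1, x.2.2.2])) ?_ ?_
  · rintro ⟨⟨⟨s, s₀⟩, s', s₀'⟩, ⟨a, b⟩, c, d⟩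
    simp only [coe_filter, mem_product, Set.mem_ofPred_eq, coe_sigma, Set.mem_sigma_iff, mem_coe,
      Fintype.mem_piFinset, Fin.forall_fin_succ, Fin.sum_univ_four, mem_filter]
    rintro ⟨⟨-, h⟩, ⟨⟨h1, h2⟩, h3, h4⟩, ⟨h5, h6⟩, h7, h8⟩
    refine ⟨⟨?_, ?_⟩, ?_⟩
    · simp [*]
    · simp [*]
    · have hs : s = s' - s₀' + s₀ := by rw [← h]; abel
      subst hs
      simp
      abel
  · rintro ⟨⟨⟨s, s₀⟩, s', s₀'⟩, ⟨a, b⟩, c, d⟩ _ ⟨⟨⟨t, t₀⟩, t', t₀'⟩, ⟨a', b'⟩, c', d'⟩ _ h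
    simp only [Prod.mk.injEq, Matrix.vecCons_inj] at h
    obtain ⟨⟨h1, h2, h3, h4, -⟩, h5, h6, h7, h8, -⟩ := h
    subst h3 h4 h7 h8
    simp only [add_right_inj] at h1 h2 h5 h6
    subst h1 h2 h5 h6
    rfl

/-! ### Almost periods: small doubling and covering. -/

/-- On average over c ∈ C, a proportion δ of the u ∈ U satisfy c + u ∈ C. Fix such a c and apply
`card_mul_le_of_popular` with threshold δ|C|. -/
theorem card_mul_le_of_almost_periods {A C U : Finset Z} {W δ : ℝ} (hCA : C ⊆ A)
    (hC : C.Nonempty) (hδ : 0 < δ) (hW : ∀ a ∈ A, (quadruplesThrough A a : ℝ) ≤ W)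
    (hU : ∀ u ∈ U, δ * C.card ≤ (diffCount C u : ℝ)) :
    (U.card : ℝ) * (δ ^ 2 * C.card) ≤ W := by
  have hsum : ∑ c ∈ C, (U.card * δ : ℝ) ≤ ∑ c ∈ C, ((U.filter fun u => c + u ∈ C).card : ℝ) := by
    calc ∑ c ∈ C, (U.card * δ : ℝ) = ∑ u ∈ U, δ * (C.card : ℝ) := by simp; ring
      _ ≤ ∑ u ∈ U, (diffCount C u : ℝ) := sum_le_sum hU
      _ = _ := by
        unfold diffCount
        exact_mod_cast (sum_card_bipartiteAbove_eq_sum_card_bipartiteBelow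
          (s := C) (t := U) (fun c u => c + u ∈ C)).symm
  obtain ⟨c, hc, hcU⟩ := exists_le_of_sum_le hC hsum
  have h1 := card_mul_le_of_popular (A := A) (U := U.filter fun u => c + u ∈ C) (c := c)
    (θ := δ * C.card) (hW c (hCA hc)) (fun d hd => hCA (mem_filter.mp hd).2)
    (fun d hd => (hU d (mem_filter.mp hd).1).trans (by exact_mod_cast diffCount_mono hCA d))
  refine le_trans ?_ h1
  calc (U.card : ℝ) * (δ ^ 2 * C.card) = U.card * δ * (δ * C.card) := by ring
    _ ≤ _ := by gcongr

theorem sum_card_filter_comm {α β : Type*} (s : Finset α) (t : Finset β) (r : α → β → Prop)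
    [∀ a b, Decidable (r a b)] :
    ∑ a ∈ s, (t.filter fun b => r a b).card = ∑ b ∈ t, (s.filter fun a => r a b).card :=
  sum_card_bipartiteAbove_eq_sum_card_bipartiteBelow r

theorem sum_card_filter_pairs (B C : Finset Z) (bad : Z × Z → Prop) [DecidablePred bad] :
    ∑ c ∈ C, (((B.filter fun b => c + b ∈ C) ×ˢ (B.filter fun b => c + b ∈ C)).filter bad).card =
      ∑ p ∈ (B ×ˢ B).filter bad, (C.filter fun c => c + p.1 ∈ C ∧ c + p.2 ∈ C).card := by
  rw [← sum_card_filter_comm C ((B ×ˢ B).filter bad) (fun c p => c + p.1 ∈ C ∧ c + p.2 ∈ C)]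
  refine sum_congr rfl fun c _ => ?_
  congr 1
  ext p
  simp only [mem_filter, mem_product]
  tauto

/-- Dependent random choice: a large part of a set `B` of almost periods of `C` has almost only
pairs with many common translates. -/
theorem exists_subset_few_bad_pairs {B C : Finset Z} {β : ℝ} (hC : C.Nonempty) (hβ : 0 < β)
    (hB : ∀ b ∈ B, β * C.card ≤ (diffCount C b : ℝ)) :
    ∃ B' ⊆ B, β ^ 2 * (B.card : ℝ) ^ 2 / 2 ≤ (B'.card : ℝ) ^ 2 ∧
      16 * (((B' ×ˢ B').filter fun p =>
        ((C.filter fun c => c + p.1 ∈ C ∧ c + p.2 ∈ C).card : ℝ) < β ^ 2 / 32 * C.card).card : ℝ)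
        ≤ (B'.card : ℝ) ^ 2 := by
  set bad : Z × Z → Prop := fun p =>
    ((C.filter fun c => c + p.1 ∈ C ∧ c + p.2 ∈ C).card : ℝ) < β ^ 2 / 32 * C.card with hbad
  set Bc : Z → Finset Z := fun c => B.filter fun b => c + b ∈ C with hBc
  have hCpos : (0 : ℝ) < C.card := by exact_mod_cast hC.card_pos
  have h1 : β * C.card * B.card ≤ ∑ c ∈ C, ((Bc c).card : ℝ) := by
    calc β * C.card * B.card = ∑ b ∈ B, β * (C.card : ℝ) := by simp; ring
      _ ≤ ∑ u ∈ B, (diffCount C u : ℝ) := sum_le_sum hB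
      _ = _ := by
        unfold diffCount
        exact_mod_cast (sum_card_filter_comm C B fun c u => c + u ∈ C).symm
  have h2 : β ^ 2 * B.card ^ 2 * C.card ≤ ∑ c ∈ C, ((Bc c).card : ℝ) ^ 2 := by
    have h3 := sq_sum_le_card_mul_sum_sq (s := C) (f := fun c => ((Bc c).card : ℝ))
    have h4 : (β * C.card * B.card) ^ 2 ≤ (∑ c ∈ C, ((Bc c).card : ℝ)) ^ 2 := by gcongr
    have h5 : C.card * (β ^ 2 * B.card ^ 2 * C.card) ≤
        C.card * ∑ c ∈ C, ((Bc c).card : ℝ) ^ 2 := by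
      refine le_trans (le_of_eq ?_) (h4.trans h3)
      ring
    exact le_of_mul_le_mul_left h5 hCpos
  have h6 : ∑ c ∈ C, ((((Bc c) ×ˢ (Bc c)).filter bad).card : ℝ) ≤
      β ^ 2 / 32 * C.card * B.card ^ 2 := by
    have h8 : ∑ c ∈ C, ((((Bc c) ×ˢ (Bc c)).filter bad).card : ℝ) =
        ∑ p ∈ (B ×ˢ B).filter bad,
          ((C.filter fun c => c + p.1 ∈ C ∧ c + p.2 ∈ C).card : ℝ) := by
      exact_mod_cast sum_card_filter_pairs B C bad
    rw [h8]
    calc _ ≤ ∑ p ∈ (B ×ˢ B).filter bad, β ^ 2 / 32 * (C.card : ℝ) :=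
          sum_le_sum fun p hp => (mem_filter.mp hp).2.le
      _ = ((B ×ˢ B).filter bad).card * (β ^ 2 / 32 * (C.card : ℝ)) := by simp
      _ ≤ (B.card ^ 2 : ℝ) * (β ^ 2 / 32 * (C.card : ℝ)) := by
        gcongr
        have := card_filter_le (B ×ˢ B) bad
        rw [card_product, ← sq] at this
        exact_mod_cast this
      _ = _ := by ring
  -- For random c, the mean of |B_c|² is at least β²|B|², while 16 times the mean number of bad
  -- pairs is at most β²|B|²/2. A single c therefore achieves both conclusions.
  have h9 : ∑ c ∈ C, (β ^ 2 * (B.card : ℝ) ^ 2 / 2) ≤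
      ∑ c ∈ C, (((Bc c).card : ℝ) ^ 2 - 16 * ((((Bc c) ×ˢ (Bc c)).filter bad).card : ℝ)) := by
    rw [sum_sub_distrib, ← mul_sum]
    simp only [sum_const, nsmul_eq_mul]
    linarith
  obtain ⟨c, -, hc⟩ := exists_le_of_sum_le hC h9
  have hn : (0 : ℝ) ≤ ((((Bc c) ×ˢ (Bc c)).filter bad).card : ℝ) := by positivity
  have hn' : (0 : ℝ) ≤ β ^ 2 * (B.card : ℝ) ^ 2 / 2 := by positivity
  exact ⟨Bc c, filter_subset _ _, by linarith, by linarith⟩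

/-- A set `B` of almost periods of `C` has a large subset with small difference set. -/
theorem exists_small_difference_of_almost_periods {A B C : Finset Z} {W β : ℝ} (hCA : C ⊆ A)
    (hC : C.Nonempty) (hβ : 0 < β) (hBne : B.Nonempty)
    (hW : ∀ a ∈ A, (quadruplesThrough A a : ℝ) ≤ W)
    (hB : ∀ b ∈ B, β * C.card ≤ (diffCount C b : ℝ)) :
    ∃ H ⊆ B, β * B.card / 2 ≤ (H.card : ℝ) ∧
      ((H - H).card : ℝ) * (β * B.card) * ((β ^ 2 / 32) ^ 2 * C.card) ^ 2 ≤ 4 * W ^ 2 := by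
  obtain ⟨B', hB'B, hB'1, hB'2⟩ := exists_subset_few_bad_pairs hC hβ hB
  set δ := β ^ 2 / 32 with hδ
  have hδpos : 0 < δ := by positivity
  set bad : Z × Z → Prop := fun p =>
    ((C.filter fun c => c + p.1 ∈ C ∧ c + p.2 ∈ C).card : ℝ) < δ * C.card with hbad
  have hBpos : (0 : ℝ) < B.card := by exact_mod_cast hBne.card_pos
  have hCpos : (0 : ℝ) < C.card := by exact_mod_cast hC.card_pos
  have hB'ge : 2 / 3 * (β * B.card) ≤ (B'.card : ℝ) := by
    refine (sq_le_sq₀ (by positivity) (by positivity)).mp ?_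
    have : 0 ≤ β ^ 2 * (B.card : ℝ) ^ 2 := by positivity
    nlinarith
  have hB'pos : (0 : ℝ) < B'.card := lt_of_lt_of_le (by positivity) hB'ge
  -- At most |B'|²/16 pairs are bad, so at most a quarter of B' is removed. For two remaining
  -- points, at least half of B' is good with both.
  set H := B'.filter fun b => 4 * ((B'.filter fun b' => bad (b, b')).card : ℝ) < B'.card with hH
  have hsdiff : ((B' \ H).card : ℝ) * 4 ≤ B'.card := by
    have h1 : ∑ b ∈ B', ((B'.filter fun b' => bad (b, b')).card : ℝ) =
        (((B' ×ˢ B').filter bad).card : ℝ) := by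
      simp only [card_filter, sum_product]
      push_cast
      rfl
    have h2 : ∑ b ∈ B' \ H, (B'.card / 4 : ℝ) ≤
        ∑ b ∈ B' \ H, ((B'.filter fun b' => bad (b, b')).card : ℝ) := by
      refine sum_le_sum fun b hb => ?_
      rw [hH, mem_sdiff, mem_filter] at hb
      have := hb.2
      push Not at this
      have := this hb.1
      linarith
    have h3 : ∑ b ∈ B' \ H, ((B'.filter fun b' => bad (b, b')).card : ℝ) ≤
        ∑ b ∈ B', ((B'.filter fun b' => bad (b, b')).card : ℝ) :=
      sum_le_sum_of_subset_of_nonneg sdiff_subset fun _ _ _ => by positivity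
    rw [sum_const, nsmul_eq_mul] at h2
    have h4 : (B'.card : ℝ) * (((B' \ H).card : ℝ) * 4) ≤ B'.card * B'.card := by nlinarith
    exact le_of_mul_le_mul_left h4 hB'pos
  have hHge : 3 / 4 * (B'.card : ℝ) ≤ H.card := by
    have := card_sdiff_add_card_eq_card (show H ⊆ B' from filter_subset _ _)
    have : ((B' \ H).card : ℝ) + H.card = B'.card := by exact_mod_cast this
    linarith
  refine ⟨H, (filter_subset _ _).trans hB'B, by linarith, ?_⟩
  set U := (B' - B').filter fun u => δ * C.card ≤ (diffCount C u : ℝ) with hU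
  have hUcard := card_mul_le_of_almost_periods (U := U) hCA hC hδpos hW
    fun u hu => (mem_filter.mp hu).2
  have hgood : ∀ b ∈ B', ∀ b' ∈ B', ¬ bad (b, b') → b - b' ∈ U := by
    intro b hb b' hb' h
    rw [hU, mem_filter]
    refine ⟨sub_mem_sub hb hb', ?_⟩
    simp only [hbad, not_lt] at h
    refine h.trans ?_
    unfold diffCount
    norm_cast
    refine Finset.card_le_card_of_injOn (fun c => c + b') ?_ fun x _ y _ h => by simpa using h
    intro c hc
    rw [mem_coe, mem_filter] at hc ⊢
    refine ⟨hc.2.2, ?_⟩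
    have : c + b' + (b - b') = c + b := by abel
    simpa [this] using hc.2.1
  -- A common good partner b writes h - h' as (h - b) - (h' - b), with both terms in U. As |U| is
  -- bounded by the quadruple count, so is |H - H|.
  have hfib : ∀ x ∈ H - H, (B'.card / 2 : ℝ) ≤
      (((U ×ˢ U).filter fun p => p.1 - p.2 = x).card : ℝ) := by
    intro x hx
    obtain ⟨h, hh, h', hh', rfl⟩ := mem_sub.mp hx
    rw [hH, mem_filter] at hh hh'
    have h1 : (B'.card / 2 : ℝ) ≤
        ((B'.filter fun b => ¬ bad (h, b) ∧ ¬ bad (h', b)).card : ℝ) := by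
      have h2 : B'.card ≤ (B'.filter fun b => bad (h, b)).card +
          (B'.filter fun b => bad (h', b)).card +
          (B'.filter fun b => ¬ bad (h, b) ∧ ¬ bad (h', b)).card := by
        refine le_trans (card_le_card ?_) ((card_union_le _ _).trans
          (Nat.add_le_add_right (card_union_le _ _) _))
        intro b hb
        simp only [mem_union, mem_filter, hb, true_and]
        tauto
      have h3 : (B'.card : ℝ) ≤ (B'.filter fun b => bad (h, b)).card +
          (B'.filter fun b => bad (h', b)).card +
          (B'.filter fun b => ¬ bad (h, b) ∧ ¬ bad (h', b)).card := by exact_mod_cast h2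
      linarith [hh.2, hh'.2]
    refine h1.trans ?_
    norm_cast
    refine Finset.card_le_card_of_injOn (fun b => (h - b, h' - b)) ?_ ?_
    · intro b hb
      rw [mem_coe, mem_filter] at hb
      simp only [coe_filter, mem_product, Set.mem_ofPred_eq]
      exact ⟨⟨hgood h hh.1 b hb.1 hb.2.1, hgood h' hh'.1 b hb.1 hb.2.2⟩, by abel⟩
    · intro b _ b' _ hbb
      simpa using congrArg Prod.fst hbb
  have hcount : ((H - H).card : ℝ) * (B'.card / 2) ≤ (U.card : ℝ) ^ 2 := by
    calc ((H - H).card : ℝ) * (B'.card / 2) = ∑ x ∈ H - H, (B'.card / 2 : ℝ) := by simp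
      _ ≤ ∑ x ∈ H - H, (((U ×ˢ U).filter fun p => p.1 - p.2 = x).card : ℝ) := sum_le_sum hfib
      _ ≤ ((U ×ˢ U).card : ℝ) := by
        norm_cast
        rw [sum_card_fiberwise_eq_card_filter]
        exact card_filter_le _ _
      _ = _ := by rw [card_product]; push_cast; ring
  have hW0 : 0 ≤ W := le_trans (by positivity) hUcard
  calc ((H - H).card : ℝ) * (β * B.card) * (δ ^ 2 * C.card) ^ 2
      ≤ ((H - H).card : ℝ) * (3 / 2 * B'.card) * (δ ^ 2 * C.card) ^ 2 := by
        gcongr ?_ * ?_ * _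
        linarith
    _ = 3 * (((H - H).card : ℝ) * (B'.card / 2)) * (δ ^ 2 * C.card) ^ 2 := by ring
    _ ≤ 3 * (U.card : ℝ) ^ 2 * (δ ^ 2 * C.card) ^ 2 := by gcongr
    _ = 3 * ((U.card : ℝ) * (δ ^ 2 * C.card)) ^ 2 := by ring
    _ ≤ 3 * W ^ 2 := by gcongr
    _ ≤ 4 * W ^ 2 := by nlinarith [sq_nonneg W]

/-- If every element of `H` is an almost period of `C`, then few translates of `H - H` cover a
positive proportion of `C`. -/
theorem exists_cover_of_almost_periods {H C : Finset Z} {β : ℝ} (hβ : 0 < β) (hHne : H.Nonempty)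
    (hH : ∀ b ∈ H, β * C.card ≤ (diffCount C b : ℝ)) :
    ∃ X : Finset Z, (X.card : ℝ) * (β * H.card) ≤ 2 * C.card ∧
      β * C.card / 2 ≤ (((X + (H - H)) ∩ C).card : ℝ) := by
  have hHpos : (0 : ℝ) < H.card := by exact_mod_cast hHne.card_pos
  set N : Z → Finset Z := fun c => C.filter fun x => x - c ∈ H with hN
  -- N c is (c + H) ∩ C. The points of C' are those where it has at least half its guaranteed
  -- average size.
  set C' := C.filter fun c => β * H.card / 2 ≤ ((N c).card : ℝ) with hC'
  have hNcard : ∀ c, (N c).card = (H.filter fun h => c + h ∈ C).card := by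
    intro c
    refine Finset.card_nbij' (fun x => x - c) (fun h => c + h) ?_ ?_ ?_ ?_ <;>
      intro a <;> simp +contextual [hN]
  have hC'card : β * C.card / 2 ≤ (C'.card : ℝ) := by
    have h1 : β * C.card * H.card ≤ ∑ c ∈ C, ((N c).card : ℝ) := by
      calc β * C.card * H.card = ∑ b ∈ H, β * (C.card : ℝ) := by simp; ring
        _ ≤ ∑ u ∈ H, (diffCount C u : ℝ) := sum_le_sum hH
        _ = _ := by
          unfold diffCount
          simp only [hNcard]
          exact_mod_cast (sum_card_filter_comm C H fun c u => c + u ∈ C).symm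
    have h2 : ∑ c ∈ C, ((N c).card : ℝ) ≤ C'.card * H.card + C.card * (β * H.card / 2) := by
      rw [← sum_filter_add_sum_filter_not C (fun c => β * H.card / 2 ≤ ((N c).card : ℝ))]
      refine add_le_add ?_ ?_
      · rw [← nsmul_eq_mul]
        refine sum_le_card_nsmul _ _ _ fun c _ => ?_
        rw [hNcard]
        exact_mod_cast card_filter_le _ _
      · refine le_trans (sum_le_card_nsmul _ _ (β * H.card / 2) fun c hc => ?_) ?_
        · exact (not_le.mp (mem_filter.mp hc).2).le
        · rw [nsmul_eq_mul]
          gcongr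
          exact filter_subset _ _
    have h3 : H.card * (β * C.card / 2) ≤ H.card * (C'.card : ℝ) := by linarith
    exact le_of_mul_le_mul_left h3 hHpos
  classical
  -- For a maximal X ⊆ C' with the sets N x disjoint, disjointness inside C bounds |X|. By
  -- maximality every N c with c ∈ C' meets some N x, which puts c in x + (H - H).
  obtain ⟨X, hX, hmax⟩ := Finset.exists_max_image
    (C'.powerset.filter fun X : Finset Z => (X : Set Z).PairwiseDisjoint N) card ⟨∅, by simp⟩
  rw [mem_filter, mem_powerset] at hX
  refine ⟨X, ?_, hC'card.trans ?_⟩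
  · have h1 : ∑ x ∈ X, (β * H.card / 2) ≤ ∑ x ∈ X, ((N x).card : ℝ) :=
      sum_le_sum fun x hx => (mem_filter.mp (hX.1 hx)).2
    have h2 : ∑ x ∈ X, ((N x).card : ℝ) ≤ C.card := by
      rw [← Nat.cast_sum, ← card_biUnion hX.2]
      exact_mod_cast card_le_card (biUnion_subset.mpr fun x _ => filter_subset _ _)
    rw [sum_const, nsmul_eq_mul] at h1
    linarith
  · norm_cast
    refine card_le_card fun c hc => mem_inter.mpr ⟨?_, (mem_filter.mp hc).1⟩
    have key : ∃ x ∈ X, ¬ Disjoint (N c) (N x) := by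
      by_contra! hcon
      have hcX : c ∉ X := by
        intro hcX
        have := hcon c hcX
        rw [disjoint_self] at this
        have h0 := (mem_filter.mp hc).2
        rw [this] at h0
        have : 0 < β * H.card / 2 := by positivity
        simp at h0
        linarith
      have := hmax (insert c X) (by
        rw [mem_filter, mem_powerset, coe_insert]
        exact ⟨insert_subset hc hX.1, hX.2.insert fun j hj _ => hcon j hj⟩)
      rw [card_insert_of_notMem hcX] at this
      omega
    obtain ⟨x, hx, hd⟩ := key
    rw [not_disjoint_iff] at hd
    obtain ⟨y, hy1, hy2⟩ := hd
    have h1 := (mem_filter.mp hy1).2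
    have h2 := (mem_filter.mp hy2).2
    exact mem_add.mpr ⟨x, hx, (y - x) - (y - c), sub_mem_sub h2 h1, by abel⟩

/-- From many almost periods `B` of a subset `C` of `A`, a set `H` of small doubling and a set `X`
such that `X + H` covers much of `C`. -/
theorem exists_symmetric_cover_of_almost_periods {A B C : Finset Z} {W β : ℝ} (hCA : C ⊆ A)
    (hC : C.Nonempty) (hβ : 0 < β) (hBne : B.Nonempty)
    (hW : ∀ a ∈ A, (quadruplesThrough A a : ℝ) ≤ W)
    (hB : ∀ b ∈ B, β * C.card ≤ (diffCount C b : ℝ)) :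
    ∃ H X : Finset Z, -H = H ∧ -X = X ∧ β * B.card / 2 ≤ (H.card : ℝ) ∧
      (H.card : ℝ) * (β * B.card) * ((β ^ 2 / 32) ^ 2 * C.card) ^ 2 ≤ 4 * W ^ 2 ∧
      (X.card : ℝ) * (β ^ 2 * B.card) ≤ 8 * C.card ∧
      ((H - H).card : ℝ) * (β * B.card / 2) ^ 4 ≤ (H.card : ℝ) ^ 5 ∧
      β * C.card / 2 ≤ (((X + H) ∩ A).card : ℝ) := by
  obtain ⟨H₀, hH₀B, hH₀card, hH₀⟩ :=
    exists_small_difference_of_almost_periods hCA hC hβ hBne hW hB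
  have hBpos : (0 : ℝ) < B.card := by exact_mod_cast hBne.card_pos
  have hH₀pos : (0 : ℝ) < H₀.card := lt_of_lt_of_le (by positivity) hH₀card
  have hH₀ne : H₀.Nonempty := by rw [← card_pos]; exact_mod_cast hH₀pos
  obtain ⟨X₀, hX₀, hX₀C⟩ := exists_cover_of_almost_periods hβ hH₀ne fun b hb => hB b (hH₀B hb)
  have hle : (H₀.card : ℝ) ≤ (H₀ - H₀).card := by
    exact_mod_cast card_le_card_sub_right hH₀ne
  refine ⟨H₀ - H₀, X₀ ∪ -X₀, neg_sub _ _, ?_, hH₀card.trans hle, hH₀, ?_, ?_, hX₀C.trans ?_⟩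
  · ext x
    simp [or_comm]
  · have h1 : ((X₀ ∪ -X₀).card : ℝ) ≤ 2 * X₀.card := by
      have := card_union_le X₀ (-X₀)
      rw [card_neg] at this
      have : ((X₀ ∪ -X₀).card : ℝ) ≤ X₀.card + X₀.card := by exact_mod_cast this
      linarith
    calc ((X₀ ∪ -X₀).card : ℝ) * (β ^ 2 * B.card)
        = 2 * ((X₀ ∪ -X₀).card : ℝ) * (β * (β * B.card / 2)) := by ring
      _ ≤ 2 * (2 * X₀.card) * (β * H₀.card) := by gcongr
      _ = 4 * (X₀.card * (β * H₀.card)) := by ring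
      _ ≤ 4 * (2 * C.card) := by gcongr
      _ = _ := by ring
  -- The difference set of H₀ - H₀ is 2H₀ - 2H₀.
  · have h1 := pluennecke_ruzsa_inequality_nsmul_sub_nsmul_sub hH₀ne H₀ 2 2
    have h2 : ((2 • H₀ - 2 • H₀).card : ℝ) ≤
        ((H₀ - H₀).card / H₀.card : ℝ) ^ (2 + 2) * H₀.card := by
      have := (NNRat.cast_le (K := ℝ)).mpr h1
      push_cast at this
      exact this
    have h3 : 2 • H₀ - 2 • H₀ = (H₀ - H₀) - (H₀ - H₀) := by
      rw [two_nsmul, add_sub_add_comm, sub_eq_add_neg (H₀ - H₀) (H₀ - H₀), neg_sub]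
    rw [h3, div_pow, div_mul_eq_mul_div, le_div_iff₀ (by positivity)] at h2
    calc (((H₀ - H₀) - (H₀ - H₀)).card : ℝ) * (β * B.card / 2) ^ 4
        ≤ (((H₀ - H₀) - (H₀ - H₀)).card : ℝ) * (H₀.card : ℝ) ^ (2 + 2) := by gcongr
      _ ≤ ((H₀ - H₀).card : ℝ) ^ (2 + 2) * H₀.card := h2
      _ ≤ ((H₀ - H₀).card : ℝ) ^ (2 + 2) * (H₀ - H₀).card := by gcongr
      _ = _ := by ring
  · norm_cast
    exact card_le_card (inter_subset_inter (add_subset_add_right subset_union_left) hCA)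

/-! ### Three-edge paths in a graph of sums. -/

/-- Points lying in a fibre with fewer than `θ` elements number at most `θ` per fibre. -/
theorem card_filter_small_fiber_le {α β : Type*} [DecidableEq β] (G : Finset α) (S : Finset β)
    (f : α → β) (hf : ∀ x ∈ G, f x ∈ S) {θ : ℝ} (hθ : 0 ≤ θ) :
    ((G.filter fun x => ((G.filter fun y => f y = f x).card : ℝ) < θ).card : ℝ) ≤ S.card * θ := by
  set b := G.filter fun x => ((G.filter fun y => f y = f x).card : ℝ) < θ with hb
  have h1 : b.card = ∑ s ∈ S, (b.filter fun x => f x = s).card :=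
    card_eq_sum_card_fiberwise fun x hx => hf x (mem_filter.mp hx).1
  rw [h1]
  push_cast
  rw [← nsmul_eq_mul]
  refine sum_le_card_nsmul _ _ _ fun s _ => ?_
  obtain h | ⟨x, hx⟩ := (b.filter fun x => f x = s).eq_empty_or_nonempty
  · simp [h, hθ]
  · rw [mem_filter, hb, mem_filter] at hx
    obtain ⟨⟨_, h2⟩, rfl⟩ := hx
    refine le_trans ?_ h2.le
    norm_cast
    apply card_le_card
    intro y hy
    rw [mem_filter] at hy ⊢
    exact ⟨(mem_filter.mp hy.1).1, hy.2⟩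

/-- A bipartite graph has at least the expected number (up to a constant) of paths with three
edges. -/
theorem card_pow_three_le_sum_paths {α β : Type*} [DecidableEq α] [DecidableEq β] {S : Finset α}
    {Y : Finset β} {G : Finset (α × β)} (hG : G ⊆ S ×ˢ Y) :
    (G.card : ℝ) ^ 3 ≤ 32 * S.card * Y.card *
      ∑ e ∈ G, ((G.filter fun x => (x.1, e.2) ∈ G).card : ℝ) := by
  obtain rfl | hne := G.eq_empty_or_nonempty
  · simp
  obtain ⟨e₀, he₀⟩ := hne
  have hS : (0 : ℝ) < S.card := by
    exact_mod_cast card_pos.mpr ⟨e₀.1, (mem_product.mp (hG he₀)).1⟩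
  have hY : (0 : ℝ) < Y.card := by
    exact_mod_cast card_pos.mpr ⟨e₀.2, (mem_product.mp (hG he₀)).2⟩
  set dS : α × β → ℝ := fun f => ((G.filter fun x => x.1 = f.1).card : ℝ) with hdS
  set dY : α × β → ℝ := fun f => ((G.filter fun x => x.2 = f.2).card : ℝ) with hdY
  -- Paths are counted by their middle edge f: the other two edges are chosen independently at its
  -- two ends.
  have hpaths : ∑ e ∈ G, ((G.filter fun x => (x.1, e.2) ∈ G).card : ℝ) =
      ∑ f ∈ G, dY f * dS f := by
    have h1 : ∀ f ∈ G, dY f * dS f =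
        (((G ×ˢ G).filter fun q => (q.2.1, q.1.2) = f).card : ℝ) := by
      intro f _
      simp only [hdY, hdS]
      norm_cast
      rw [← card_product]
      congr 1
      ext q
      simp only [mem_filter, mem_product, Prod.ext_iff]
      tauto
    rw [sum_congr rfl h1]
    norm_cast
    rw [sum_card_fiberwise_eq_card_filter]
    simp only [card_filter, sum_product]
  rw [hpaths]
  set g : ℝ := (G.card : ℝ) with hg
  have hg0 : 0 ≤ g := by positivity
  have b1 := card_filter_small_fiber_le G S Prod.fst
    (fun x hx => (mem_product.mp (hG hx)).1) (θ := g / (4 * S.card)) (by positivity)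
  have b2 := card_filter_small_fiber_le G Y Prod.snd
    (fun x hx => (mem_product.mp (hG hx)).2) (θ := g / (4 * Y.card)) (by positivity)
  have e1 : S.card * (g / (4 * S.card)) = g / 4 := by field_simp
  have e2 : Y.card * (g / (4 * Y.card)) = g / 4 := by field_simp
  rw [e1] at b1
  rw [e2] at b2
  -- Each of the two degree conditions fails on at most a quarter of the edges, so half of the edges
  -- serve as middle edges with both end degrees large.
  set good := G.filter fun f => g / (4 * S.card) ≤ dS f ∧ g / (4 * Y.card) ≤ dY f with hgood
  have hgoodcard : g / 2 ≤ (good.card : ℝ) := by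
    have h : G.card ≤ (G.filter fun f => dS f < g / (4 * S.card)).card +
        (G.filter fun f => dY f < g / (4 * Y.card)).card + good.card := by
      refine le_trans (card_le_card ?_) ((card_union_le _ _).trans
          (Nat.add_le_add_right (card_union_le _ _) _))
      intro f hf
      simp only [hgood, mem_union, mem_filter, hf, true_and]
      by_cases h1 : g / (4 * S.card) ≤ dS f <;> by_cases h2 : g / (4 * Y.card) ≤ dY f <;>
        simp [h1, h2, not_le.mp]
    have h' : g ≤ ((G.filter fun f => dS f < g / (4 * S.card)).card : ℝ) +
        (G.filter fun f => dY f < g / (4 * Y.card)).card + good.card := by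
      rw [hg]
      exact_mod_cast h
    linarith
  have hlow : (good.card : ℝ) * (g / (4 * Y.card) * (g / (4 * S.card))) ≤
      ∑ f ∈ G, dY f * dS f := by
    rw [← nsmul_eq_mul]
    refine le_trans (card_nsmul_le_sum good (fun f => dY f * dS f) _ fun f hf => ?_)
      (sum_le_sum_of_subset_of_nonneg (filter_subset _ _) fun _ _ _ => by positivity)
    have := (mem_filter.mp hf).2
    gcongr
    · exact this.2
    · exact this.1
  calc g ^ 3 = 32 * S.card * Y.card * (g / 2 * (g / (4 * Y.card) * (g / (4 * S.card)))) := by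
        field_simp; ring
    _ ≤ 32 * S.card * Y.card * (good.card * (g / (4 * Y.card) * (g / (4 * S.card)))) := by
        gcongr
    _ ≤ _ := by gcongr

/-- Cauchy–Schwarz for intersections of a family of subsets of `Ω`. -/
theorem sq_sum_card_le_mul_sum_inter {ι α : Type*} [DecidableEq α] (E : Finset ι) (Ω : Finset α)
    (V : ι → Finset α) (hV : ∀ e ∈ E, V e ⊆ Ω) :
    (∑ e ∈ E, ((V e).card : ℝ)) ^ 2 ≤
      Ω.card * ∑ e' ∈ E, ∑ e ∈ E, ((V e ∩ V e').card : ℝ) := by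
  have h1 : ∑ e ∈ E, ((V e).card : ℝ) = ∑ x ∈ Ω, ((E.filter fun e => x ∈ V e).card : ℝ) := by
    have : ∑ e ∈ E, (V e).card = ∑ e ∈ E, (Ω.filter fun x => x ∈ V e).card := by
      refine sum_congr rfl fun e he => ?_
      rw [filter_mem_eq_inter, inter_eq_right.mpr (hV e he)]
    have h := this.trans (sum_card_filter_comm E Ω fun e x => x ∈ V e)
    exact_mod_cast h
  have h2 : ∑ e' ∈ E, ∑ e ∈ E, ((V e ∩ V e').card : ℝ) =
      ∑ x ∈ Ω, ((E.filter fun e => x ∈ V e).card : ℝ) ^ 2 := by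
    have h3 : ∑ q ∈ E ×ˢ E, (V q.2 ∩ V q.1).card =
        ∑ q ∈ E ×ˢ E, (Ω.filter fun x => x ∈ V q.2 ∧ x ∈ V q.1).card := by
      refine sum_congr rfl fun q hq => ?_
      congr 1
      ext x
      simp only [mem_inter, mem_filter]
      exact ⟨fun h => ⟨hV _ (mem_product.mp hq).1 h.2, h⟩, fun h => h.2⟩
    have h4 := h3.trans (sum_card_filter_comm (E ×ˢ E) Ω fun q x => x ∈ V q.2 ∧ x ∈ V q.1)
    rw [sum_product] at h4
    have h5 : ∀ x ∈ Ω, ((E ×ˢ E).filter fun q => x ∈ V q.2 ∧ x ∈ V q.1).card =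
        (E.filter fun e => x ∈ V e).card ^ 2 := by
      intro x _
      rw [sq, ← card_product]
      congr 1
      ext q
      simp only [mem_filter, mem_product]
      tauto
    rw [sum_congr rfl h5] at h4
    exact_mod_cast h4
  rw [h1, h2]
  exact sq_sum_le_card_mul_sum_sq

/-- The ends of the three-edge paths in `G` starting with the edge `e`, recorded relative to `e`,
where the two left vertices of the path have at least `θ` common neighbours. -/
noncomputable def pathEnds (G : Finset (Z × Z)) (θ : ℝ) (e : Z × Z) : Finset (Z × Z) :=
  (G.filter fun x => (x.1, e.2) ∈ G ∧
    θ ≤ ((G.filter fun f => f.1 = e.1 ∧ (x.1, f.2) ∈ G).card : ℝ)).image fun x => (x.1 - e.1, x.2)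

theorem card_pathEnds (G : Finset (Z × Z)) (θ : ℝ) (e : Z × Z) :
    (pathEnds G θ e).card = (G.filter fun x => (x.1, e.2) ∈ G ∧
    θ ≤ ((G.filter fun f => f.1 = e.1 ∧ (x.1, f.2) ∈ G).card : ℝ)).card := by
  refine card_image_of_injective _ fun x y h => ?_
  simp only [Prod.mk.injEq, sub_left_inj] at h
  exact Prod.ext h.1 h.2

/-- The paths discarded by `pathEnds` are few: a pair of left vertices with fewer than θ common
neighbours leaves fewer than θ choices for the vertex between them and |Y| for the last one. -/
theorem sum_card_pathEnds {S Y : Finset Z} {G : Finset (Z × Z)} (hG : G ⊆ S ×ˢ Y) {θ : ℝ}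
    (hθ : 0 ≤ θ) :
    (G.card : ℝ) ^ 3 ≤ 32 * S.card * Y.card *
      (∑ e ∈ G, ((pathEnds G θ e).card : ℝ) + S.card ^ 2 * Y.card * θ) := by
  refine (card_pow_three_le_sum_paths hG).trans ?_
  gcongr
  set comm : Z → Z → ℕ := fun s t => (G.filter fun f => f.1 = s ∧ (t, f.2) ∈ G).card with hcomm
  have h1 : ∀ e ∈ G, ((G.filter fun x => (x.1, e.2) ∈ G).card : ℝ) =
      ((pathEnds G θ e).card : ℝ) +
      ((G.filter fun x => (x.1, e.2) ∈ G ∧ ¬ θ ≤ (comm e.1 x.1 : ℝ)).card : ℝ) := by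
    intro e _
    rw [card_pathEnds]
    norm_cast
    rw [← card_filter_add_card_filter_not (s := G.filter fun x => (x.1, e.2) ∈ G)
      (fun x => θ ≤ (comm e.1 x.1 : ℝ)), filter_filter, filter_filter]
  rw [sum_congr rfl h1, sum_add_distrib]
  gcongr
  have h2 : ∑ e ∈ G, ((G.filter fun x => (x.1, e.2) ∈ G ∧ ¬ θ ≤ (comm e.1 x.1 : ℝ)).card) ≤
      ∑ q ∈ (S ×ˢ S).filter (fun q => ¬ θ ≤ (comm q.1 q.2 : ℝ)), comm q.1 q.2 * Y.card := by
    rw [← card_sigma]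
    have h3 : ∀ q : Z × Z, comm q.1 q.2 * Y.card =
        ((G.filter fun f => f.1 = q.1 ∧ (q.2, f.2) ∈ G) ×ˢ Y).card := by
      intro q; rw [card_product]
    simp only [h3]
    rw [← card_sigma]
    refine Finset.card_le_card_of_injOn (fun w => ⟨(w.1.1, w.2.1), (w.1, w.2.2)⟩) ?_ ?_
    · rintro ⟨e, x⟩ h
      simp only [coe_sigma, Set.mem_sigma_iff, mem_coe, mem_filter, mem_product] at h ⊢
      obtain ⟨he, hx, h4, h5⟩ := h
      have := mem_product.mp (hG he)
      have := mem_product.mp (hG hx)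
      tauto
    · rintro ⟨e, x⟩ _ ⟨e', x'⟩ _ h
      simp only [Sigma.mk.injEq, Prod.mk.injEq] at h
      obtain ⟨⟨-, h1⟩, h2⟩ := h
      rw [heq_eq_eq, Prod.mk.injEq] at h2
      obtain ⟨rfl, h3⟩ := h2
      rw [Prod.ext h1 h3]
  calc ∑ e ∈ G, ((G.filter fun x => (x.1, e.2) ∈ G ∧ ¬ θ ≤ (comm e.1 x.1 : ℝ)).card : ℝ)
      ≤ ∑ q ∈ (S ×ˢ S).filter (fun q => ¬ θ ≤ (comm q.1 q.2 : ℝ)), (comm q.1 q.2 * Y.card : ℝ) := by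
        exact_mod_cast h2
    _ ≤ ∑ q ∈ (S ×ˢ S).filter (fun q => ¬ θ ≤ (comm q.1 q.2 : ℝ)), (θ * Y.card : ℝ) := by
        refine sum_le_sum fun q hq => ?_
        have := not_le.mp (mem_filter.mp hq).2
        gcongr
    _ = ((S ×ˢ S).filter (fun q => ¬ θ ≤ (comm q.1 q.2 : ℝ))).card * (θ * Y.card) := by simp
    _ ≤ ((S.card ^ 2 : ℕ) : ℝ) * (θ * Y.card) := by
        gcongr
        rw [sq, ← card_product]
        exact card_filter_le _ _
    _ = _ := by push_cast; ring

/-- A common relative end comes from two edges of G with the same right vertex, whose left vertices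
differ by exactly e'.1 - e.1. -/
theorem card_inter_pathEnds_le (G : Finset (Z × Z)) (θ : ℝ) (e e' : Z × Z) :
    (pathEnds G θ e ∩ pathEnds G θ e').card ≤
      (G.filter fun x => (x.1 + (e'.1 - e.1), x.2) ∈ G).card := by
  refine Finset.card_le_card_of_injOn (fun x => (x.1 + e.1, x.2)) ?_ ?_
  · intro x hx
    rw [mem_coe, mem_inter, pathEnds, pathEnds, mem_image, mem_image] at hx
    obtain ⟨⟨y, hy, rfl⟩, z, hz, h⟩ := hx
    rw [mem_filter] at hy hz
    rw [Prod.mk.injEq] at h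
    rw [mem_coe, mem_filter]
    have h1 : (y.1 - e.1 + e.1, y.2) = y := by simp
    have h2 : (y.1 - e.1 + e.1 + (e'.1 - e.1), y.2) = z := by
      rw [← h.1, ← h.2]
      ext
      · simp
      · rfl
    simp only
    rw [h1, h2]
    exact ⟨hy.1, hz.1⟩
  · intro x _ y _ h
    simp only [Prod.mk.injEq, add_left_inj] at h
    exact Prod.ext h.1 h.2

/-- If x and its translate by z are both edges, their sums c and c + z both lie in C, and each c is
the sum of at most u edges. -/
theorem card_translates_le {C : Finset Z} {G : Finset (Z × Z)} {u : ℝ}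
    (hC : ∀ x ∈ G, x.2 + x.1 ∈ C)
    (hu : ∀ c ∈ C, ((G.filter fun x => x.2 + x.1 = c).card : ℝ) ≤ u) (z : Z) :
    ((G.filter fun x => (x.1 + z, x.2) ∈ G).card : ℝ) ≤ u * diffCount C z := by
  have h1 : (G.filter fun x => (x.1 + z, x.2) ∈ G).card = ∑ c ∈ C.filter fun a => a + z ∈ C,
      ((G.filter fun x => (x.1 + z, x.2) ∈ G).filter fun x => x.2 + x.1 = c).card := by
    refine card_eq_sum_card_fiberwise fun x hx => ?_
    rw [mem_coe, mem_filter] at hx ⊢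
    refine ⟨hC x hx.1, ?_⟩
    have := hC _ hx.2
    rwa [← add_assoc] at this
  rw [h1]
  push_cast
  rw [mul_comm]
  unfold diffCount
  rw [← nsmul_eq_mul]
  refine sum_le_card_nsmul _ _ _ fun c hc => (le_trans ?_ (hu c (mem_filter.mp hc).1))
  norm_cast
  apply card_le_card
  intro x hx
  simp only [mem_filter] at hx ⊢
  exact ⟨hx.1.1, hx.2⟩

/-- The common neighbours of two left vertices represent their difference d as a difference in A, so
d is popular. The constraint on d involves e only through the sum e.2 + e.1, so all edges with one
sum share one box. -/
theorem pathEnds_subset {A S Y : Finset Z} {G : Finset (Z × Z)} (hG : G ⊆ S ×ˢ Y)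
    (hGA : ∀ x ∈ G, x.2 + x.1 ∈ A) (θ : ℝ) (e : Z × Z) (he : e ∈ G) :
    pathEnds G θ e ⊆ ((A - A).filter fun d => e.2 + e.1 + d ∈ A ∧ θ ≤ (diffCount A d : ℝ)) ×ˢ Y := by
  intro w hw
  rw [pathEnds, mem_image] at hw
  obtain ⟨x, hx, rfl⟩ := hw
  rw [mem_filter] at hx
  have h1 := hGA _ hx.2.1
  have h2 : e.2 + e.1 + (x.1 - e.1) = e.2 + x.1 := by abel
  rw [mem_product, mem_filter]
  refine ⟨⟨?_, by rw [h2]; exact h1, hx.2.2.trans ?_⟩, (mem_product.mp (hG hx.1)).2⟩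
  · exact mem_sub.mpr ⟨_, h1, _, hGA e he, add_sub_add_left_eq_sub _ _ _⟩
  · norm_cast
    refine Finset.card_le_card_of_injOn (fun f => f.2 + e.1) ?_ ?_
    · intro f hf
      rw [mem_coe, mem_filter] at hf ⊢
      obtain ⟨hf, h3, h4⟩ := hf
      refine ⟨h3 ▸ hGA f hf, ?_⟩
      have : f.2 + e.1 + (x.1 - e.1) = f.2 + x.1 := by abel
      rw [this]
      exact hGA _ h4
    · intro f hf f' hf' h
      rw [mem_coe, mem_filter] at hf hf'
      simp only [add_left_inj] at h
      exact Prod.ext (hf.2.1.trans hf'.2.1.symm) h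

/-- Over edges with sum c, the sets `pathEnds G θ e` lie in U × Y with |U| ≤ W/θ. Cauchy–Schwarz in
so small a box forces large pairwise intersections. -/
theorem sq_sum_card_pathEnds_le {A S Y : Finset Z} {G : Finset (Z × Z)} {W θ : ℝ}
    (hG : G ⊆ S ×ˢ Y) (hGA : ∀ x ∈ G, x.2 + x.1 ∈ A) (c : Z)
    (hW : (quadruplesThrough A c : ℝ) ≤ W) (hθ : 0 < θ) :
    θ * (∑ e ∈ G.filter (fun x => x.2 + x.1 = c), ((pathEnds G θ e).card : ℝ)) ^ 2 ≤
      (W * Y.card) * ∑ e' ∈ G.filter (fun x => x.2 + x.1 = c),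
        ∑ e ∈ G.filter (fun x => x.2 + x.1 = c),
          ((pathEnds G θ e ∩ pathEnds G θ e').card : ℝ) := by
  set U := (A - A).filter fun d => c + d ∈ A ∧ θ ≤ (diffCount A d : ℝ) with hU
  have h2 := card_mul_le_of_popular (U := U) hW
    (fun d hd => (mem_filter.mp hd).2.1) (fun d hd => (mem_filter.mp hd).2.2)
  have h3 := sq_sum_card_le_mul_sum_inter (G.filter fun x => x.2 + x.1 = c) (U ×ˢ Y)
    (pathEnds G θ) (by
      intro e he
      rw [mem_filter] at he
      have := pathEnds_subset hG hGA θ e he.1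
      rwa [he.2] at this)
  rw [card_product] at h3
  push_cast at h3
  have hQ : 0 ≤ ∑ e' ∈ G.filter (fun x => x.2 + x.1 = c),
      ∑ e ∈ G.filter (fun x => x.2 + x.1 = c),
        ((pathEnds G θ e ∩ pathEnds G θ e').card : ℝ) :=
    sum_nonneg fun _ _ => sum_nonneg fun _ _ => Nat.cast_nonneg _
  generalize ∑ e' ∈ G.filter (fun x => x.2 + x.1 = c),
      ∑ e ∈ G.filter (fun x => x.2 + x.1 = c),
        ((pathEnds G θ e ∩ pathEnds G θ e').card : ℝ) = Q at h3 hQ ⊢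
  generalize ∑ e ∈ G.filter (fun x => x.2 + x.1 = c), ((pathEnds G θ e).card : ℝ) = R at h3 ⊢
  calc θ * R ^ 2 ≤ θ * (U.card * Y.card * Q) := by gcongr
    _ = U.card * θ * (Y.card * Q) := by ring
    _ ≤ W * (Y.card * Q) := by gcongr
    _ = W * Y.card * Q := by ring

theorem mul_sq_sum_le_of_forall {ι : Type*} (s : Finset ι) (f g : ι → ℝ) {θ w : ℝ} (hθ : 0 ≤ θ)
    (h : ∀ i ∈ s, θ * f i ^ 2 ≤ w * g i) :
    θ * (∑ i ∈ s, f i) ^ 2 ≤ s.card * w * ∑ i ∈ s, g i := by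
  calc θ * (∑ i ∈ s, f i) ^ 2 ≤ θ * (s.card * ∑ i ∈ s, f i ^ 2) := by
        gcongr
        exact sq_sum_le_card_mul_sum_sq
    _ = s.card * ∑ i ∈ s, θ * f i ^ 2 := by rw [← mul_sum]; ring
    _ ≤ s.card * ∑ i ∈ s, w * g i :=
        mul_le_mul_of_nonneg_left (sum_le_sum h) (Nat.cast_nonneg _)
    _ = _ := by rw [← mul_sum]; ring

/-- A dense graph `G` of pairs whose sums lie in `C ⊆ A`, with sums taken at most `u` times, gives
at most `u` translations with a large total number of coincidences `C ∩ (C - z)`. -/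
theorem exists_translations_of_graph {A S Y C : Finset Z} {G : Finset (Z × Z)} {W u θ : ℝ}
    (hG : G ⊆ S ×ˢ Y) (hGne : G.Nonempty) (hCA : C ⊆ A) (hGC : ∀ x ∈ G, x.2 + x.1 ∈ C)
    (hu : ∀ c ∈ C, ((G.filter fun x => x.2 + x.1 = c).card : ℝ) ≤ u) (hθ : 0 < θ)
    (hW : ∀ a ∈ A, (quadruplesThrough A a : ℝ) ≤ W) :
    ∃ B : Finset Z, (B.card : ℝ) ≤ u ∧
      θ * (∑ e ∈ G, ((pathEnds G θ e).card : ℝ)) ^ 2 ≤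
        C.card * (W * Y.card) * G.card * (u * ∑ z ∈ B, (diffCount C z : ℝ)) := by
  set F : Z → Finset (Z × Z) := fun c => G.filter fun x => x.2 + x.1 = c with hF
  have hsum : ∑ e ∈ G, ((pathEnds G θ e).card : ℝ) =
      ∑ c ∈ C, ∑ e ∈ F c, ((pathEnds G θ e).card : ℝ) :=
    (sum_fiberwise_of_maps_to hGC _).symm
  have h1 : ∀ c ∈ C, θ * (∑ e ∈ F c, ((pathEnds G θ e).card : ℝ)) ^ 2 ≤
      (W * Y.card) * ∑ e' ∈ F c, ∑ e ∈ F c, ((pathEnds G θ e ∩ pathEnds G θ e').card : ℝ) :=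
    fun c hc => sq_sum_card_pathEnds_le hG (fun x hx => hCA (hGC x hx)) c (hW c (hCA hc)) hθ
  have hW0 : 0 ≤ W := by
    obtain ⟨e, he⟩ := hGne
    exact le_trans (by positivity) (hW _ (hCA (hGC e he)))
  have h4 : θ * (∑ e ∈ G, ((pathEnds G θ e).card : ℝ)) ^ 2 ≤ C.card * (W * Y.card) *
      ∑ e' ∈ G, ∑ e ∈ F (e'.2 + e'.1), ((pathEnds G θ e ∩ pathEnds G θ e').card : ℝ) := by
    have h5 : ∑ e' ∈ G, ∑ e ∈ F (e'.2 + e'.1), ((pathEnds G θ e ∩ pathEnds G θ e').card : ℝ) =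
        ∑ c ∈ C, ∑ e' ∈ F c, ∑ e ∈ F c, ((pathEnds G θ e ∩ pathEnds G θ e').card : ℝ) := by
      rw [← sum_fiberwise_of_maps_to hGC]
      refine sum_congr rfl fun c _ => sum_congr rfl fun e' he' => ?_
      rw [(mem_filter.mp he').2]
    rw [h5, hsum]
    exact mul_sq_sum_le_of_forall C _ _ hθ.le h1
  obtain ⟨e', he', hmax⟩ := exists_max_image G
    (fun e' => ∑ e ∈ F (e'.2 + e'.1), ((pathEnds G θ e ∩ pathEnds G θ e').card : ℝ)) hGne
  -- Edges with a fixed sum are determined by their left vertex, so distinct edges e give distinct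
  -- translations.
  have hinj : Set.InjOn (fun e : Z × Z => e'.1 - e.1) (F (e'.2 + e'.1)) := by
    intro x hx y hy h
    simp only [hF, coe_filter, Set.mem_ofPred_eq] at hx hy
    simp only [sub_right_inj] at h
    have h2 := hx.2.trans hy.2.symm
    rw [h, add_left_inj] at h2
    exact Prod.ext h h2
  refine ⟨(F (e'.2 + e'.1)).image fun e => e'.1 - e.1, ?_, h4.trans ?_⟩
  · refine le_trans ?_ (hu _ (hGC e' he'))
    exact_mod_cast card_image_le
  · rw [mul_assoc (C.card * (W * Y.card) : ℝ)]
    gcongr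
    rw [← nsmul_eq_mul]
    refine sum_le_card_nsmul _ _ _ fun e he => (hmax e he).trans ?_
    rw [sum_image hinj, mul_sum]
    refine sum_le_sum fun x _ => le_trans ?_ (card_translates_le hGC hu _)
    exact_mod_cast card_inter_pathEnds_le G θ x e'

/-! ### Regularising the sums and extracting almost periods. -/

/-- Pigeonholing of weights among the scales `[L ^ i, L ^ (i + 1))`. -/
theorem exists_scale {ι : Type*} (s : Finset ι) (w v : ι → ℝ) {L : ℝ} {J : ℕ} (hJ : 0 < J)
    (hw : ∀ i ∈ s, 0 ≤ w i) (hv1 : ∀ i ∈ s, 1 ≤ v i) (hv : ∀ i ∈ s, v i < L ^ J) :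
    ∃ k < J, ∑ i ∈ s, w i ≤ J * ∑ i ∈ s.filter (fun i => L ^ k ≤ v i ∧ v i < L ^ (k + 1)), w i := by
  have h : ∀ n : ℕ, ∑ i ∈ s.filter (fun i => v i < L ^ n), w i ≤ ∑ k ∈ range n,
      ∑ i ∈ s.filter (fun i => L ^ k ≤ v i ∧ v i < L ^ (k + 1)), w i := by
    intro n
    induction n with
    | zero =>
      rw [filter_eq_empty_iff.mpr fun i hi => by simpa using hv1 i hi]
      simp
    | succ n ih =>
      rw [sum_range_succ]
      refine le_trans ?_ (add_le_add_left ih _)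
      rw [← sum_filter_add_sum_filter_not (s.filter fun i => v i < L ^ (n + 1))
        (fun i => v i < L ^ n)]
      refine add_le_add ?_ ?_
      · refine sum_le_sum_of_subset_of_nonneg ?_ fun i hi _ => hw i (mem_filter.mp hi).1
        intro i hi
        simp only [mem_filter] at hi ⊢
        exact ⟨hi.1.1, hi.2⟩
      · refine sum_le_sum_of_subset_of_nonneg ?_ fun i hi _ => hw i (mem_filter.mp hi).1
        intro i hi
        simp only [mem_filter, not_lt] at hi ⊢
        exact ⟨hi.1.1, hi.2, hi.1.2⟩
  have h1 := h J
  rw [filter_true_of_mem hv] at h1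
  obtain ⟨k, hk, hmax⟩ := exists_max_image (range J) (fun k =>
    ∑ i ∈ s.filter (fun i => L ^ k ≤ v i ∧ v i < L ^ (k + 1)), w i) ⟨0, mem_range.mpr hJ⟩
  refine ⟨k, mem_range.mp hk, h1.trans ?_⟩
  have h2 := sum_le_card_nsmul _ _ _ hmax
  rwa [card_range, nsmul_eq_mul] at h2

theorem card_sum_fiber_le (G : Finset (Z × Z)) {S Y : Finset Z} (hG : G ⊆ S ×ˢ Y) (c : Z) :
    (G.filter fun x => x.2 + x.1 = c).card ≤ Y.card := by
  refine card_le_card_of_injOn Prod.snd (fun x hx => ?_) fun x hx y hy h => ?_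
  · exact (mem_product.mp (hG (mem_filter.mp hx).1)).2
  · have h1 := (mem_filter.mp hx).2.trans (mem_filter.mp hy).2.symm
    rw [h, add_right_inj] at h1
    exact Prod.ext h1 h

/-- The sums of a graph can be restricted to those occurring at a common scale. -/
theorem exists_subgraph_regular_sums {S Y : Finset Z} {G : Finset (Z × Z)} {L : ℝ} {J : ℕ}
    (hG : G ⊆ S ×ˢ Y) (hGne : G.Nonempty) (hJ : 0 < J) (hJL : (J : ℝ) ≤ L)
    (hY : (Y.card : ℝ) < L ^ J) :
    ∃ G' ⊆ G, ∃ t : ℝ, 0 < t ∧ G'.Nonempty ∧ (G.card : ℝ) ≤ L * G'.card ∧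
      ((G'.image fun x => x.2 + x.1).card : ℝ) * t ≤ G'.card ∧
      ∀ c, ((G'.filter fun x => x.2 + x.1 = c).card : ℝ) ≤ L * t := by
  set m : Z → ℝ := fun c => ((G.filter fun x => x.2 + x.1 = c).card : ℝ) with hm
  have hL : 0 < L := lt_of_lt_of_le (by exact_mod_cast hJ) hJL
  obtain ⟨k, -, hk⟩ := exists_scale G (fun _ => (1 : ℝ)) (fun x => m (x.2 + x.1)) hJ
    (fun _ _ => zero_le_one) (fun x hx => by
      simp only [hm]
      norm_cast
      exact card_pos.mpr ⟨x, mem_filter.mpr ⟨hx, rfl⟩⟩)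
    (fun x _ => lt_of_le_of_lt (Nat.cast_le.mpr (card_sum_fiber_le G hG _)) hY)
  simp only [sum_const, nsmul_eq_mul, mul_one] at hk
  set G' := G.filter fun x => L ^ k ≤ m (x.2 + x.1) ∧ m (x.2 + x.1) < L ^ (k + 1) with hG'
  have hGG' : (G.card : ℝ) ≤ L * G'.card := hk.trans (by gcongr)
  -- Fibres of the sum map are kept or dropped whole, so multiplicities in G' agree with those in G.
  have hfib : ∀ x ∈ G', (G'.filter fun y => y.2 + y.1 = x.2 + x.1) =
      G.filter fun y => y.2 + y.1 = x.2 + x.1 := by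
    intro x hx
    rw [hG', filter_filter]
    refine filter_congr fun y _ => ⟨fun h => h.2, fun h => ⟨?_, h⟩⟩
    rw [h]
    exact (mem_filter.mp hx).2
  refine ⟨G', filter_subset _ _, L ^ k, by positivity, ?_, hGG', ?_, fun c => ?_⟩
  · by_contra h
    rw [not_nonempty_iff_eq_empty] at h
    rw [h, card_empty, Nat.cast_zero, mul_zero] at hGG'
    have : (0 : ℝ) < G.card := by exact_mod_cast hGne.card_pos
    linarith
  · have h1 : G'.card = ∑ c ∈ G'.image fun x => x.2 + x.1,
        (G'.filter fun x => x.2 + x.1 = c).card :=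
      card_eq_sum_card_fiberwise fun x hx => mem_image_of_mem _ hx
    rw [h1]
    push_cast
    rw [← nsmul_eq_mul]
    refine card_nsmul_le_sum _ _ _ fun c hc => ?_
    obtain ⟨x, hx, rfl⟩ := mem_image.mp hc
    rw [hfib x hx]
    exact (mem_filter.mp hx).2.1
  · obtain h | ⟨x, hx⟩ := (G'.filter fun x => x.2 + x.1 = c).eq_empty_or_nonempty
    · rw [h]
      simp only [card_empty, Nat.cast_zero]
      positivity
    · obtain ⟨hx', rfl⟩ := mem_filter.mp hx
      rw [hfib x hx', ← pow_succ']
      exact (mem_filter.mp hx').2.2.le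

/-- Cubing the density loss L^13 costs L^39; the further L^6 ≥ 64 makes the discarded term 32x²/L^6
at most half of x². Hence 45 = 39 + 6. -/
theorem sq_le_of_path_bound {L x g N : ℝ} (hL : 2 ≤ L) (hx : 0 < x) (hN : 0 ≤ N)
    (hg : x ≤ L ^ 13 * g) (h : g ^ 3 ≤ 32 * x * (N + x ^ 2 / L ^ 45)) :
    x ^ 2 ≤ L ^ 45 * N := by
  have hL0 : 0 < L := by linarith
  have hL6 : 64 ≤ L ^ 6 := by
    calc (64 : ℝ) = 2 ^ 6 := by norm_num
      _ ≤ L ^ 6 := by gcongr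
  have h2 : x ^ 3 ≤ L ^ 39 * (32 * x * (N + x ^ 2 / L ^ 45)) := by
    calc x ^ 3 ≤ (L ^ 13 * g) ^ 3 := by gcongr
      _ = L ^ 39 * g ^ 3 := by ring
      _ ≤ _ := by gcongr
  have h3 : x * x ^ 2 ≤ x * (32 * L ^ 39 * N + 32 * (x ^ 2 / L ^ 6)) := by
    refine le_trans (le_of_eq (by ring)) (h2.trans (le_of_eq ?_))
    rw [show L ^ 45 = L ^ 39 * L ^ 6 by ring]
    have ha : L ^ 39 ≠ 0 := pow_ne_zero _ hL0.ne'
    have hb : L ^ 6 ≠ 0 := pow_ne_zero _ hL0.ne'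
    generalize L ^ 39 = a at *
    generalize L ^ 6 = b at *
    field_simp
  have h4 := le_of_mul_le_mul_left h3 hx
  have h5 : 32 * (x ^ 2 / L ^ 6) ≤ x ^ 2 / 2 := by
    rw [mul_div_assoc', div_le_div_iff₀ (by positivity) (by norm_num)]
    nlinarith [sq_nonneg x]
  calc x ^ 2 ≤ 64 * (L ^ 39 * N) := by linarith
    _ ≤ L ^ 6 * (L ^ 39 * N) := by gcongr
    _ = _ := by ring

/-- The exponent is 143 = 3·45 + 1 + 7: one 45 from θ, two from squaring the bound on N, then the
fibre bound and the bound on W. -/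
theorem le_of_translation_bound {L p x N T g c W : ℝ} (hL : 0 < L) (hp : 0 < p) (hx : 0 < x)
    (hT : 0 ≤ T) (hg : 0 ≤ g) (hc : 0 ≤ c) (h1 : x ^ 2 ≤ L ^ 45 * N)
    (h2 : p / L ^ 45 * N ^ 2 ≤ c * W * p * g * L * T) (hcx : c ≤ x) (hgx : g ≤ x)
    (hW : W ≤ L ^ 7 * x) : x ≤ L ^ 143 * T := by
  have h45 : L ^ 135 * (p / L ^ 45 * N ^ 2) = p * (L ^ 45 * N) ^ 2 := by
    rw [show L ^ 135 = L ^ 45 * (L ^ 45 * L ^ 45) by ring]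
    have : L ^ 45 ≠ 0 := by positivity
    generalize L ^ 45 = a at *
    field_simp
  have h3 : p * x ^ 4 ≤ p * x ^ 3 * (L ^ 143 * T) := by
    calc p * x ^ 4 = p * (x ^ 2) ^ 2 := by ring
      _ ≤ p * (L ^ 45 * N) ^ 2 := by gcongr
      _ = L ^ 135 * (p / L ^ 45 * N ^ 2) := h45.symm
      _ ≤ L ^ 135 * (c * W * p * g * L * T) := by gcongr
      _ = L ^ 136 * p * (c * g * T) * W := by ring
      _ ≤ L ^ 136 * p * (c * g * T) * (L ^ 7 * x) :=
        mul_le_mul_of_nonneg_left hW (mul_nonneg (mul_nonneg (pow_pos hL _).le hp.le)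
          (mul_nonneg (mul_nonneg hc hg) hT))
      _ ≤ L ^ 136 * p * (x * x * T) * (L ^ 7 * x) := by gcongr
      _ = _ := by ring
  have h4 : (p * x ^ 3) * x ≤ (p * x ^ 3) * (L ^ 143 * T) := le_trans (le_of_eq (by ring)) h3
  exact le_of_mul_le_mul_left h4 (by positivity)

/-- At threshold L^(-145), the poor translations contribute at most x/L after multiplication by
L^143. This is at most x/2 and is absorbed. -/
theorem le_of_split_bound {L x T c t b : ℝ} (hL : 2 ≤ L) (hx : 0 ≤ x) (h : x ≤ L ^ 143 * T)
    (hT : T ≤ b * c + L * (L ^ 145)⁻¹ * (c * t)) (hc : c * t ≤ x) : x ≤ L ^ 144 * (b * c) := by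
  have hL0 : 0 < L := by linarith
  have h1 : L ^ 144 * (L * (L ^ 145)⁻¹) = 1 := by
    rw [show L ^ 145 = L ^ 144 * L by ring]
    have : L ^ 144 ≠ 0 := by positivity
    generalize L ^ 144 = a at *
    field_simp
  have h2 : L ^ 144 * T ≤ L ^ 144 * (b * c) + c * t := by
    calc L ^ 144 * T ≤ L ^ 144 * (b * c + L * (L ^ 145)⁻¹ * (c * t)) := by gcongr
      _ = L ^ 144 * (b * c) + (L ^ 144 * (L * (L ^ 145)⁻¹)) * (c * t) := by ring
      _ = _ := by rw [h1, one_mul]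
  have h3 : L * x ≤ L ^ 144 * T := by
    calc L * x ≤ L * (L ^ 143 * T) := by gcongr
      _ = _ := by ring
  nlinarith

/-- A dense graph of pairs with sums in `A` yields a subset `C` of `A` with many almost periods. -/
theorem exists_almost_periods_of_graph {A S Y : Finset Z} {G : Finset (Z × Z)} {W L : ℝ} {J : ℕ}
    (hG : G ⊆ S ×ˢ Y) (hGne : G.Nonempty) (hGA : ∀ x ∈ G, x.2 + x.1 ∈ A)
    (hL : 2 ≤ L) (hJ : 0 < J) (hJL : (J : ℝ) ≤ L) (hY : (Y.card : ℝ) < L ^ J)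
    (hdense : (S.card : ℝ) * Y.card ≤ L ^ 12 * G.card) (hWG : W ≤ L ^ 7 * G.card)
    (hW : ∀ a ∈ A, (quadruplesThrough A a : ℝ) ≤ W) :
    ∃ C ⊆ A, ∃ B : Finset Z, C.Nonempty ∧ B.Nonempty ∧
      (∀ z ∈ B, (L ^ 145)⁻¹ * C.card ≤ (diffCount C z : ℝ)) ∧
      (G.card : ℝ) ≤ L ^ 144 * (B.card * C.card) := by
  obtain ⟨G', hG'G, t, ht, hG'ne, hGG', hCt, hfib⟩ :=
    exists_subgraph_regular_sums hG hGne hJ hJL hY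
  have hG' := hG'G.trans hG
  set C := G'.image fun x => x.2 + x.1 with hC
  have hCA : C ⊆ A := by
    intro c hc
    obtain ⟨x, hx, rfl⟩ := mem_image.mp hc
    exact hGA x (hG'G hx)
  have hL0 : 0 < L := by linarith
  obtain ⟨x₀, hx₀⟩ := hG'ne
  have hS : (0 : ℝ) < S.card := by
    exact_mod_cast card_pos.mpr ⟨x₀.1, (mem_product.mp (hG' hx₀)).1⟩
  have hYpos : (0 : ℝ) < Y.card := by
    exact_mod_cast card_pos.mpr ⟨x₀.2, (mem_product.mp (hG' hx₀)).2⟩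
  have hCne : C.Nonempty := ⟨_, mem_image_of_mem _ hx₀⟩
  have hCpos : (0 : ℝ) < C.card := by exact_mod_cast hCne.card_pos
  set q : ℝ := (S.card : ℝ) with hq
  set p : ℝ := (Y.card : ℝ) with hp
  set g : ℝ := (G'.card : ℝ) with hg
  have hgpos : 0 < g := by
    rw [hg]
    exact_mod_cast card_pos.mpr ⟨x₀, hx₀⟩
  have hPg : q * p ≤ L ^ 13 * g := by
    calc q * p ≤ L ^ 12 * G.card := hdense
      _ ≤ L ^ 12 * (L * g) := by gcongr
      _ = _ := by ring
  have hGP : (G.card : ℝ) ≤ q * p := by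
    have := card_le_card hG
    rw [card_product] at this
    rw [hq, hp]
    exact_mod_cast this
  have hgG : g ≤ G.card := by
    rw [hg]
    exact_mod_cast card_le_card hG'G
  set θ := p / L ^ 45 with hθ
  have hθpos : 0 < θ := by positivity
  have h1 := sum_card_pathEnds hG' hθpos.le
  set N := ∑ e ∈ G', ((pathEnds G' θ e).card : ℝ) with hN
  have hN0 : 0 ≤ N := sum_nonneg fun _ _ => Nat.cast_nonneg _
  have hNlow : (q * p) ^ 2 ≤ L ^ 45 * N :=
    sq_le_of_path_bound hL (by positivity) hN0 hPg (h1.trans (le_of_eq (by rw [hθ]; ring)))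
  obtain ⟨B₀, hB₀, h2⟩ := exists_translations_of_graph hG' ⟨x₀, hx₀⟩ hCA
    (fun x hx => mem_image_of_mem _ hx) (fun c _ => hfib c) hθpos hW
  set Tr := ∑ z ∈ B₀, (diffCount C z : ℝ) with hT
  have hT0 : 0 ≤ Tr := sum_nonneg fun _ _ => Nat.cast_nonneg _
  have hkey : q * p ≤ L ^ 143 * Tr := by
    refine le_of_translation_bound hL0 hYpos (x := q * p) (by positivity) hT0 hgpos.le
      (by positivity : 0 ≤ C.card * t) hNlow (h2.trans (le_of_eq (by ring)))
      (hCt.trans (hgG.trans hGP)) (hgG.trans hGP) (hWG.trans (by gcongr))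
  set B := B₀.filter fun z => (L ^ 145)⁻¹ * C.card ≤ (diffCount C z : ℝ) with hB
  have hsplit : Tr ≤ B.card * C.card + (L * t) * ((L ^ 145)⁻¹ * C.card) := by
    rw [hT, ← sum_filter_add_sum_filter_not B₀
      (fun z => (L ^ 145)⁻¹ * C.card ≤ (diffCount C z : ℝ))]
    refine add_le_add ?_ ?_
    · rw [← nsmul_eq_mul]
      refine sum_le_card_nsmul _ _ _ fun z _ => ?_
      exact_mod_cast diffCount_le_card C z
    · refine le_trans (sum_le_card_nsmul _ _ ((L ^ 145)⁻¹ * C.card) fun z hz =>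
        (not_le.mp (mem_filter.mp hz).2).le) ?_
      rw [nsmul_eq_mul]
      gcongr
      refine le_trans ?_ hB₀
      exact_mod_cast card_filter_le _ _
  have hfin : q * p ≤ L ^ 144 * (B.card * C.card) :=
    le_of_split_bound hL (by positivity) hkey (hsplit.trans (le_of_eq (by ring))) (hCt.trans (hgG.trans hGP))
  refine ⟨C, hCA, B, hCne, ?_, fun z hz => (mem_filter.mp hz).2, hGP.trans hfin⟩
  rw [← card_pos]
  have h3 : 0 < q * p := by positivity
  have h4 : (0 : ℝ) < B.card := by
    by_contra h
    have h5 : (B.card : ℝ) = 0 := le_antisymm (not_lt.mp h) (Nat.cast_nonneg _)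
    rw [h5, zero_mul, mul_zero] at hfin
    linarith
  exact_mod_cast h4

/-! ### From energies to a dense graph. -/

/-- The number of `o ∈ A` with `o + s` and `o + t` both in `A`. -/
def commonCount (A : Finset Z) (s t : Z) : ℕ := (A.filter fun o => o + s ∈ A ∧ o + t ∈ A).card

theorem commonCount_le_diffCount_sub (A : Finset Z) (s t : Z) :
    commonCount A s t ≤ diffCount A (s - t) := by
  refine card_le_card_of_injOn (fun o => o + t) (fun o ho => ?_) fun x _ y _ h => by simpa using h
  rw [mem_coe, mem_filter] at ho ⊢
  refine ⟨ho.2.2, ?_⟩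
  have : o + t + (s - t) = o + s := by abel
  rw [this]
  exact ho.2.1

/-- Expanding one factor r(s) as a sum over base points o ∈ A and applying Cauchy–Schwarz in o
produces pairs s, t with a common base point. -/
theorem sq_sum_sq_diffCount_le (A D : Finset Z) :
    (∑ s ∈ D, (diffCount A s : ℝ) ^ 2) ^ 2 ≤ A.card * ∑ q ∈ D ×ˢ D,
      (diffCount A q.1 * diffCount A q.2 * commonCount A q.1 q.2 : ℝ) := by
  set f : Z → Z → ℝ := fun o s => if o + s ∈ A then (diffCount A s : ℝ) else 0 with hf
  have h1 : ∑ s ∈ D, (diffCount A s : ℝ) ^ 2 = ∑ o ∈ A, ∑ s ∈ D, f o s := by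
    rw [sum_comm]
    refine sum_congr rfl fun s _ => ?_
    simp only [hf]
    rw [← sum_filter, sum_const, nsmul_eq_mul, sq]
    rfl
  have h2 : ∑ q ∈ D ×ˢ D, (diffCount A q.1 * diffCount A q.2 * commonCount A q.1 q.2 : ℝ) =
      ∑ o ∈ A, (∑ s ∈ D, f o s) ^ 2 := by
    have h3 : ∀ o ∈ A, (∑ s ∈ D, f o s) ^ 2 = ∑ q ∈ D ×ˢ D, f o q.1 * f o q.2 := by
      intro o _
      rw [sq, sum_mul_sum, sum_product]
    rw [sum_congr rfl h3, sum_comm]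
    refine sum_congr rfl fun q _ => ?_
    have h4 : ∀ o ∈ A, f o q.1 * f o q.2 =
        if o + q.1 ∈ A ∧ o + q.2 ∈ A then (diffCount A q.1 * diffCount A q.2 : ℝ) else 0 := by
      intro o _
      simp only [hf]
      by_cases h5 : o + q.1 ∈ A <;> by_cases h6 : o + q.2 ∈ A <;> simp [h5, h6]
    rw [sum_congr rfl h4, ← sum_filter, sum_const, nsmul_eq_mul, mul_comm]
    rfl
  rw [h1, h2]
  exact sq_sum_le_card_mul_sum_sq

/-- Group the pairs by x = s - t and apply Cauchy–Schwarz in x: the squared group weights are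
controlled by the eightfold energy, and the factors r(x) leave only the energy carried by X. -/
theorem sq_sum_diffCount_triple_le (A D X : Finset Z) :
    (∑ q ∈ (D ×ˢ D).filter (fun q => q.1 - q.2 ∈ X),
      (diffCount A q.1 * diffCount A q.2 * diffCount A (q.1 - q.2) : ℝ)) ^ 2 ≤
      energyTwoMul 4 A * ∑ x ∈ X, (diffCount A x : ℝ) ^ 2 := by
  set h : Z × Z → ℝ := fun q => (diffCount A q.1 * diffCount A q.2 : ℝ) with hh
  set R : Z → ℝ := fun x => ∑ q ∈ (D ×ˢ D).filter (fun q => q.1 - q.2 = x), h q with hR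
  have h1 : ∑ q ∈ (D ×ˢ D).filter (fun q => q.1 - q.2 ∈ X),
      (diffCount A q.1 * diffCount A q.2 * diffCount A (q.1 - q.2) : ℝ) =
      ∑ x ∈ X, R x * diffCount A x := by
    rw [← sum_fiberwise_of_maps_to (s := (D ×ˢ D).filter (fun q => q.1 - q.2 ∈ X)) (t := X)
      (g := fun q => q.1 - q.2) (fun q hq => (mem_filter.mp hq).2)]
    refine sum_congr rfl fun x hx => ?_
    rw [hR, sum_mul]
    have : ((D ×ˢ D).filter (fun q => q.1 - q.2 ∈ X)).filter (fun q => q.1 - q.2 = x) =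
        (D ×ˢ D).filter (fun q => q.1 - q.2 = x) := by
      rw [filter_filter]
      exact filter_congr fun q _ => ⟨fun h => h.2, fun h => ⟨h ▸ hx, h⟩⟩
    rw [this]
    refine sum_congr rfl fun q hq => ?_
    rw [(mem_filter.mp hq).2]
  have h2 : ∑ x ∈ X, R x ^ 2 ≤ energyTwoMul 4 A := by
    have h3 := sum_diffCount_le_energyTwoMul_four A D
    have h4 : ∑ q ∈ ((D ×ˢ D) ×ˢ (D ×ˢ D)).filter (fun q => q.1.1 - q.1.2 = q.2.1 - q.2.2),
        h q.1 * h q.2 ≤ energyTwoMul 4 A := by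
      simp only [hh]
      exact_mod_cast h3
    refine le_trans ?_ h4
    have h5 : ∀ x ∈ X, R x ^ 2 =
        ∑ q ∈ ((D ×ˢ D) ×ˢ (D ×ˢ D)).filter
          (fun q => q.1.1 - q.1.2 = x ∧ q.2.1 - q.2.2 = x), h q.1 * h q.2 := by
      intro x _
      simp only [hR]
      rw [sq, sum_mul_sum, ← sum_product']
      refine sum_congr ?_ fun _ _ => rfl
      ext q
      simp only [mem_filter, mem_product]
      tauto
    rw [sum_congr rfl h5]
    have hnn : ∀ q : (Z × Z) × (Z × Z), 0 ≤ h q.1 * h q.2 := fun q => by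
      simp only [hh]; positivity
    refine le_trans (le_of_eq ?_) (sum_le_sum_of_subset_of_nonneg
      (filter_subset (fun q => q.1.1 - q.1.2 ∈ X) _) fun q _ _ => hnn q)
    rw [← sum_fiberwise_of_maps_to (t := X) (g := fun q : (Z × Z) × (Z × Z) => q.1.1 - q.1.2)
      (fun q hq => (mem_filter.mp hq).2)]
    refine sum_congr rfl fun x hx => sum_congr ?_ fun _ _ => rfl
    ext q
    simp only [mem_filter]
    constructor
    · rintro ⟨h0, h1, h2⟩
      exact ⟨⟨⟨h0, h1.trans h2.symm⟩, h1 ▸ hx⟩, h1⟩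
    · rintro ⟨⟨⟨h0, h1⟩, -⟩, h3⟩
      exact ⟨h0, h3, h1 ▸ h3⟩
  rw [h1]
  exact (sum_mul_sq_le_sq_mul_sq _ _ _).trans (by gcongr)

/-- When a dyadic-type range of difference counts carries energy `E` and the energy of the smaller
counts is negligible compared with what the eightfold energy permits, most pairs of popular
differences have a popular difference again and many common translates. -/
theorem sq_energy_le_of_negligible {A : Finset Z} {P η : ℝ} (hη : 0 < η)
    (D : Finset Z) (hD : 0 < ∑ s ∈ D, (diffCount A s : ℝ) ^ 2)
    (hlow : 9 * energyTwoMul 4 A * (A.card : ℝ) ^ 2 *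
      ∑ x ∈ (A - A).filter (fun x => (diffCount A x : ℝ) < P), (diffCount A x : ℝ) ^ 2 ≤
      (∑ s ∈ D, (diffCount A s : ℝ) ^ 2) ^ 4)
    (hη4 : 9 * energyTwoMul 4 A * (A.card : ℝ) ^ 2 * (η ^ 2 * energyTwoMul 2 A) ≤
      (∑ s ∈ D, (diffCount A s : ℝ) ^ 2) ^ 4) :
    (∑ s ∈ D, (diffCount A s : ℝ) ^ 2) ^ 2 ≤ 3 * A.card *
      ∑ q ∈ (D ×ˢ D).filter (fun q => η * P ≤ (commonCount A q.1 q.2 : ℝ)),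
        (diffCount A q.1 * diffCount A q.2 * commonCount A q.1 q.2 : ℝ) := by
  have h0 := sq_sum_sq_diffCount_le A D
  set E := ∑ s ∈ D, (diffCount A s : ℝ) ^ 2 with hE
  set Xl := (A - A).filter (fun x => (diffCount A x : ℝ) < P) with hXl
  set Sl := ∑ q ∈ (D ×ˢ D).filter (fun q => q.1 - q.2 ∈ Xl),
      (diffCount A q.1 * diffCount A q.2 * diffCount A (q.1 - q.2) : ℝ) with hSl
  set Sh := ∑ q ∈ (D ×ˢ D).filter (fun q => q.1 - q.2 ∈ A - A),
      (diffCount A q.1 * diffCount A q.2 * diffCount A (q.1 - q.2) : ℝ) with hSh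
  have hl := sq_sum_diffCount_triple_le A D Xl
  have hh := sq_sum_diffCount_triple_le A D (A - A)
  rw [← hSl] at hl
  rw [← hSh] at hh
  have e4 : ∑ x ∈ A - A, (diffCount A x : ℝ) ^ 2 = energyTwoMul 2 A := by
    rw [energyTwoMul_two_eq_sum]
    push_cast
    rfl
  rw [e4] at hh
  -- Each discarded part is at most a third of E²; the factor 9 in the hypotheses is 3².
  have hSl' : A.card * Sl ≤ E ^ 2 / 3 := by
    refine abs_le_of_sq_le_sq' ?_ (by positivity) |>.2
    calc (A.card * Sl) ^ 2 = (A.card : ℝ) ^ 2 * Sl ^ 2 := by ring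
      _ ≤ (A.card : ℝ) ^ 2 * (energyTwoMul 4 A * ∑ x ∈ Xl, (diffCount A x : ℝ) ^ 2) := by gcongr
      _ ≤ (E ^ 2 / 3) ^ 2 := by nlinarith
  have hSh' : A.card * (η * Sh) ≤ E ^ 2 / 3 := by
    refine abs_le_of_sq_le_sq' ?_ (by positivity) |>.2
    calc (A.card * (η * Sh)) ^ 2 = (A.card : ℝ) ^ 2 * η ^ 2 * Sh ^ 2 := by ring
      _ ≤ (A.card : ℝ) ^ 2 * η ^ 2 * (energyTwoMul 4 A * energyTwoMul 2 A) := by gcongr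
      _ ≤ (E ^ 2 / 3) ^ 2 := by nlinarith
  have hsplit : ∑ q ∈ D ×ˢ D,
      (diffCount A q.1 * diffCount A q.2 * commonCount A q.1 q.2 : ℝ) ≤
      ∑ q ∈ (D ×ˢ D).filter (fun q => η * P ≤ (commonCount A q.1 q.2 : ℝ)),
        (diffCount A q.1 * diffCount A q.2 * commonCount A q.1 q.2 : ℝ) + Sl + η * Sh := by
    rw [hSl, hSh, mul_sum, sum_filter, sum_filter, sum_filter, ← sum_add_distrib,
      ← sum_add_distrib]
    refine sum_le_sum fun q _ => ?_
    have hw : (0 : ℝ) ≤ diffCount A q.1 * diffCount A q.2 := by positivity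
    have hnr : (commonCount A q.1 q.2 : ℝ) ≤ diffCount A (q.1 - q.2) := by
      exact_mod_cast commonCount_le_diffCount_sub A q.1 q.2
    have hn0 : (0 : ℝ) ≤ commonCount A q.1 q.2 := by positivity
    generalize (diffCount A q.1 * diffCount A q.2 : ℝ) = w at hw ⊢
    have hmem : 0 < (diffCount A (q.1 - q.2) : ℝ) → q.1 - q.2 ∈ A - A := fun h =>
      mem_sub_self_of_diffCount_pos (by exact_mod_cast h)
    have hXmem : q.1 - q.2 ∈ Xl ↔ q.1 - q.2 ∈ A - A ∧ (diffCount A (q.1 - q.2) : ℝ) < P := by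
      rw [hXl, mem_filter]
    generalize (diffCount A (q.1 - q.2) : ℝ) = r at hnr hmem hXmem ⊢
    generalize (commonCount A q.1 q.2 : ℝ) = n at hnr hn0 ⊢
    have hr0 : 0 ≤ r := hn0.trans hnr
    have hwr : 0 ≤ w * r := mul_nonneg hw hr0
    have hwn : w * n ≤ w * r := by gcongr
    have hwn0 : 0 ≤ w * n := mul_nonneg hw hn0
    have t2 : 0 ≤ if q.1 - q.2 ∈ Xl then w * r else 0 := by split_ifs <;> simp [hwr]
    have t3 : 0 ≤ if q.1 - q.2 ∈ A - A then η * (w * r) else 0 := by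
      split_ifs
      · positivity
      · exact le_rfl
    -- A pair outside the main sum has either r(s - t) < P, counted by Sl, or fewer than ηP ≤ η r(s
    -- - t) base points, counted by η Sh.
    by_cases c1 : η * P ≤ n
    · rw [if_pos c1]
      linarith
    rw [if_neg c1]
    rw [not_le] at c1
    obtain hr | hr := hr0.eq_or_lt
    · rw [← hr, mul_zero] at hwn
      linarith
    have hA := hmem hr
    rw [if_pos hA] at t3 ⊢
    by_cases c2 : r < P
    · rw [if_pos (hXmem.mpr ⟨hA, c2⟩)]
      linarith
    · rw [not_lt] at c2
      have : w * n ≤ w * (η * r) := by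
        gcongr
        exact c1.le.trans (by gcongr)
      linarith
  have hM : (0 : ℝ) ≤ A.card := by positivity
  have := mul_le_mul_of_nonneg_left hsplit hM
  linarith

/-- A set whose eightfold energy is as small as its additive energy permits contains a dense graph
of sums. -/
theorem exists_graph_of_energy {A : Finset Z} {P L η W : ℝ} (hP : 0 < P) (hη : 0 < η) (hL : 0 < L)
    (D : Finset Z) (hD1 : ∀ d ∈ D, P ≤ (diffCount A d : ℝ))
    (hD2 : ∀ d ∈ D, (diffCount A d : ℝ) < L * P)
    (hD : 0 < ∑ s ∈ D, (diffCount A s : ℝ) ^ 2)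
    (hlow : 9 * energyTwoMul 4 A * (A.card : ℝ) ^ 2 *
      ∑ x ∈ (A - A).filter (fun x => (diffCount A x : ℝ) < P), (diffCount A x : ℝ) ^ 2 ≤
      (∑ s ∈ D, (diffCount A s : ℝ) ^ 2) ^ 4)
    (hη4 : 9 * energyTwoMul 4 A * (A.card : ℝ) ^ 2 * (η ^ 2 * energyTwoMul 2 A) ≤
      (∑ s ∈ D, (diffCount A s : ℝ) ^ 2) ^ 4)
    (hW : ∀ a ∈ A, (quadruplesThrough A a : ℝ) ≤ W) :
    ∃ S Y : Finset Z, ∃ G ⊆ S ×ˢ Y, Y ⊆ A ∧ (∀ x ∈ G, x.2 + x.1 ∈ A) ∧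
      ∑ s ∈ D, (diffCount A s : ℝ) ^ 2 ≤ 3 * A.card * L ^ 2 * G.card ∧
      (S.card : ℝ) * Y.card * η ≤ L ^ 2 * W := by
  have h1 := sq_energy_le_of_negligible hη D hD hlow hη4
  set E := ∑ s ∈ D, (diffCount A s : ℝ) ^ 2 with hE
  have hDne : D.Nonempty := by
    by_contra h
    rw [not_nonempty_iff_eq_empty] at h
    rw [hE, h, sum_empty] at hD
    exact lt_irrefl _ hD
  set g : Z → ℝ := fun t =>
    ∑ s ∈ D.filter (fun s => η * P ≤ (commonCount A s t : ℝ)), (commonCount A s t : ℝ) with hg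
  have h2 : ∑ q ∈ (D ×ˢ D).filter (fun q => η * P ≤ (commonCount A q.1 q.2 : ℝ)),
      (diffCount A q.1 * diffCount A q.2 * commonCount A q.1 q.2 : ℝ) ≤
      (L * P) ^ 2 * ∑ t ∈ D, g t := by
    have h3 : ∑ t ∈ D, g t = ∑ q ∈ (D ×ˢ D).filter
        (fun q => η * P ≤ (commonCount A q.1 q.2 : ℝ)), (commonCount A q.1 q.2 : ℝ) := by
      simp only [hg, sum_filter]
      rw [sum_product_right]
    rw [h3, mul_sum]
    refine sum_le_sum fun q hq => ?_
    have hq := mem_product.mp (mem_filter.mp hq).1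
    rw [sq]
    have a1 := (hD2 _ hq.1).le
    have a2 := (hD2 _ hq.2).le
    gcongr
  -- The best t is at least average. Since |D|P² ≤ E, one factor E cancels and leaves a lower bound
  -- on g t, which will be the number of edges.
  obtain ⟨t, htD, hmax⟩ := exists_max_image D g hDne
  have h3 : ∑ t ∈ D, g t ≤ D.card * g t := by
    rw [← nsmul_eq_mul]
    exact sum_le_card_nsmul _ _ _ hmax
  have h4 : D.card * P ^ 2 ≤ E := by
    rw [← nsmul_eq_mul]
    refine card_nsmul_le_sum _ _ _ fun d hd => ?_
    have := hD1 d hd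
    gcongr
  have hg0 : 0 ≤ g t := sum_nonneg fun _ _ => Nat.cast_nonneg _
  have h5 : E ≤ 3 * A.card * L ^ 2 * g t := by
    have h6 : E * E ≤ E * (3 * A.card * L ^ 2 * g t) := by
      calc E * E = E ^ 2 := by ring
        _ ≤ 3 * A.card * ((L * P) ^ 2 * (D.card * g t)) := by
          refine h1.trans ?_
          gcongr
          exact h2.trans (by gcongr)
        _ = 3 * A.card * L ^ 2 * g t * (D.card * P ^ 2) := by ring
        _ ≤ 3 * A.card * L ^ 2 * g t * E := by gcongr
        _ = _ := by ring
    exact le_of_mul_le_mul_left h6 hD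
  set S := D.filter (fun s => η * P ≤ (commonCount A s t : ℝ)) with hS
  set Y := A.filter (fun o => o + t ∈ A) with hY
  set G := (S ×ˢ Y).filter (fun x => x.2 + x.1 ∈ A) with hG
  have hGg : (G.card : ℝ) = g t := by
    have : G.card = ∑ s ∈ S, commonCount A s t := by
      rw [hG, card_filter, sum_product]
      refine sum_congr rfl fun s _ => ?_
      rw [← card_filter, hY, filter_filter]
      unfold commonCount
      congr 1
      exact filter_congr fun o _ => and_comm
    rw [this]
    push_cast
    rfl
  have hYcard : (Y.card : ℝ) < L * P := hD2 t htD
  -- All of S is popular, so each base point o has at most W/P neighbours. Combined with the minimum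
  -- degree ηP on the S side, this bounds |S||Y|.
  have hGW : G.card * P ≤ Y.card * W := by
    have h6 : G.card = ∑ o ∈ Y, (S.filter fun s => o + s ∈ A).card := by
      rw [hG, card_filter, sum_product_right]
      exact sum_congr rfl fun o _ => (card_filter _ _).symm
    rw [h6]
    push_cast
    rw [sum_mul, ← nsmul_eq_mul]
    refine sum_le_card_nsmul _ _ _ fun o ho => ?_
    exact card_mul_le_of_popular (hW o (mem_filter.mp ho).1) (fun d hd => (mem_filter.mp hd).2)
      (fun d hd => hD1 d (mem_filter.mp (mem_filter.mp hd).1).1)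
  have hSG : S.card * (η * P) ≤ G.card := by
    rw [hGg, ← nsmul_eq_mul]
    exact card_nsmul_le_sum _ _ _ fun s hs => (mem_filter.mp hs).2
  refine ⟨S, Y, G, filter_subset _ _, filter_subset _ _, fun x hx => (mem_filter.mp hx).2,
    by rw [hGg]; exact h5, ?_⟩
  have hW0 : 0 ≤ W := by
    have hA : (0 : ℝ) < Y.card := lt_of_lt_of_le hP (hD1 t htD)
    have hA' : 0 < Y.card := by exact_mod_cast hA
    obtain ⟨o, ho⟩ := card_pos.mp hA'
    exact le_trans (Nat.cast_nonneg _) (hW o (mem_filter.mp ho).1)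
  have h7 : P ^ 2 * ((S.card : ℝ) * Y.card * η) ≤ P ^ 2 * (L ^ 2 * W) := by
    calc P ^ 2 * ((S.card : ℝ) * Y.card * η) = (S.card * (η * P)) * P * Y.card := by ring
      _ ≤ (G.card * P) * Y.card :=
        mul_le_mul_of_nonneg_right (mul_le_mul_of_nonneg_right hSG hP.le) (Nat.cast_nonneg _)
      _ ≤ (Y.card * W) * Y.card := by gcongr
      _ = W * (Y.card : ℝ) ^ 2 := by ring
      _ ≤ W * (L * P) ^ 2 := by gcongr
      _ = _ := by ring
  exact le_of_mul_le_mul_left h7 (by positivity)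

/-! ### The structure theorem with explicit losses. -/

/-- `H` has small doubling, and boundedly many translates of it cover a subset of `A` of size about
`c`, up to factors `Λ`. -/
structure IsCoverUpTo (A H X : Finset Z) (T c Λ : ℝ) : Prop where
  neg_left : -H = H
  neg_right : -X = X
  le_card : T ≤ Λ * (c * H.card)
  card_le : H.card * c ≤ Λ * T
  card_cover_le : X.card * T ≤ Λ * c ^ 2
  card_sub_le : ((H - H).card : ℝ) ≤ Λ * H.card
  le_card_inter : c ≤ Λ * ((X + H) ∩ A).card

/-- The upper bound on |H| times |B||C| ≥ T/Λ gives |H||C| ≲ T, hence |H| ≤ Λ^18 |B|, so H and B are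
comparable. The largest loss is in the doubling bound: 77 = 4·18 + 5. -/
theorem isCoverUpTo_of_almost_periods {A B C : Finset Z} {T Λ W : ℝ} (hCA : C ⊆ A)
    (hC : C.Nonempty) (hBne : B.Nonempty) (hΛ : 32 ≤ Λ) (hT : 0 < T) (hWT : 4 * W ^ 2 ≤ Λ ^ 3 * T ^ 2)
    (hW : ∀ a ∈ A, (quadruplesThrough A a : ℝ) ≤ W)
    (hB : ∀ b ∈ B, Λ⁻¹ * C.card ≤ (diffCount C b : ℝ))
    (hTB : T ≤ Λ * (B.card * C.card)) :
    ∃ H X : Finset Z, IsCoverUpTo A H X T C.card (Λ ^ 77) := by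
  have hΛ0 : 0 < Λ := by linarith
  have hΛ1 : 1 ≤ Λ := by linarith
  obtain ⟨H, X, hH, hX, h1, h2, h3, h4, h5⟩ :=
    exists_symmetric_cover_of_almost_periods hCA hC (inv_pos.mpr hΛ0) hBne hW hB
  have hb : (0 : ℝ) < B.card := by exact_mod_cast hBne.card_pos
  have hc : (0 : ℝ) < C.card := by exact_mod_cast hC.card_pos
  have hh : (0 : ℝ) ≤ H.card := Nat.cast_nonneg _
  have hx : (0 : ℝ) ≤ X.card := Nat.cast_nonneg _
  have hd : (0 : ℝ) ≤ (H - H).card := Nat.cast_nonneg _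
  have hi : (0 : ℝ) ≤ ((X + H) ∩ A).card := Nat.cast_nonneg _
  generalize (B.card : ℝ) = b at *
  generalize (C.card : ℝ) = c at *
  have hbh : b ≤ 2 * Λ * H.card := by
    have : Λ * (Λ⁻¹ * b / 2) ≤ Λ * H.card := by gcongr
    rw [mul_div_assoc', mul_inv_cancel_left₀ hΛ0.ne'] at this
    linarith
  have hHc : H.card * c ≤ Λ ^ 17 * T := by
    have e : (H.card : ℝ) * (Λ⁻¹ * b) * (((Λ⁻¹) ^ 2 / 32) ^ 2 * c) ^ 2 * (32 ^ 4 * Λ ^ 9) =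
        H.card * b * c ^ 2 := by
      field_simp
    have h6 : (T * (H.card * c)) ≤ T * (Λ ^ 17 * T) := by
      calc T * (H.card * c) ≤ (Λ * (b * c)) * (H.card * c) := by gcongr
        _ = Λ * (H.card * b * c ^ 2) := by ring
        _ = Λ * ((H.card : ℝ) * (Λ⁻¹ * b) * (((Λ⁻¹) ^ 2 / 32) ^ 2 * c) ^ 2 * (32 ^ 4 * Λ ^ 9)) := by
            rw [e]
        _ ≤ Λ * (Λ ^ 3 * T ^ 2 * (32 ^ 4 * Λ ^ 9)) := by
            gcongr Λ * (?_ * _)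
            exact h2.trans hWT
        _ ≤ Λ * (Λ ^ 3 * T ^ 2 * (Λ ^ 4 * Λ ^ 9)) := by gcongr
        _ = _ := by ring
    exact le_of_mul_le_mul_left h6 hT
  have hHb : H.card ≤ Λ ^ 18 * b := by
    have h6 : c * H.card ≤ c * (Λ ^ 18 * b) := by
      calc c * H.card = H.card * c := mul_comm _ _
        _ ≤ Λ ^ 17 * T := hHc
        _ ≤ Λ ^ 17 * (Λ * (b * c)) := by gcongr
        _ = _ := by ring
    exact le_of_mul_le_mul_left h6 hc
  refine ⟨H, X, hH, hX, ?_, ?_, ?_, ?_, ?_⟩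
  · calc T ≤ Λ * (b * c) := hTB
      _ ≤ Λ * (2 * Λ * H.card * c) := by gcongr
      _ = 2 * Λ ^ 2 * (c * H.card) := by ring
      _ ≤ Λ * Λ ^ 2 * (c * H.card) := by gcongr; linarith
      _ = Λ ^ 3 * (c * H.card) := by ring
      _ ≤ _ := by gcongr; norm_num
  · exact hHc.trans (by gcongr; norm_num)
  · have h6 : (X.card : ℝ) * b ≤ 8 * c * Λ ^ 2 := by
      calc (X.card : ℝ) * b = X.card * (Λ⁻¹ ^ 2 * b) * Λ ^ 2 := by field_simp
        _ ≤ _ := by gcongr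
    calc X.card * T ≤ X.card * (Λ * (b * c)) := by gcongr
      _ = Λ * c * (X.card * b) := by ring
      _ ≤ Λ * c * (8 * c * Λ ^ 2) := by gcongr
      _ = 8 * Λ ^ 3 * c ^ 2 := by ring
      _ ≤ Λ * Λ ^ 3 * c ^ 2 := by gcongr; linarith
      _ = Λ ^ 4 * c ^ 2 := by ring
      _ ≤ _ := by gcongr; norm_num
  · have e : ((H - H).card : ℝ) * b ^ 4 = 16 * Λ ^ 4 * ((H - H).card * (Λ⁻¹ * b / 2) ^ 4) := by
      field_simp
      norm_num
    have h6 : b ^ 4 * ((H - H).card : ℝ) ≤ b ^ 4 * (Λ ^ 77 * H.card) := by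
      calc b ^ 4 * ((H - H).card : ℝ) = 16 * Λ ^ 4 * ((H - H).card * (Λ⁻¹ * b / 2) ^ 4) := by
            rw [mul_comm, e]
        _ ≤ 16 * Λ ^ 4 * (H.card : ℝ) ^ 5 := by gcongr
        _ = 16 * Λ ^ 4 * ((H.card : ℝ) ^ 4 * H.card) := by ring
        _ ≤ Λ * Λ ^ 4 * ((Λ ^ 18 * b) ^ 4 * H.card) := by gcongr; linarith
        _ = _ := by ring
    exact le_of_mul_le_mul_left h6 (by positivity)
  · have h6 : Λ * (Λ⁻¹ * c / 2) ≤ Λ * ((X + H) ∩ A).card := by gcongr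
    rw [mul_div_assoc', mul_inv_cancel_left₀ hΛ0.ne'] at h6
    calc c ≤ 2 * Λ * ((X + H) ∩ A).card := by linarith
      _ ≤ Λ * Λ * ((X + H) ∩ A).card := by gcongr; linarith
      _ = Λ ^ 2 * ((X + H) ∩ A).card := by ring
      _ ≤ _ := by gcongr; norm_num

theorem exists_jump {F a : ℕ → ℝ} {J : ℕ} (h0 : F 0 < a 0) (hJ : a J ≤ F J) :
    ∃ i < J, F i < a i ∧ a (i + 1) ≤ F (i + 1) := by
  induction J with
  | zero => exact absurd h0 (not_lt.mpr hJ)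
  | succ n ih =>
    by_cases h : a n ≤ F n
    · obtain ⟨i, hi, h1⟩ := ih h
      exact ⟨i, by omega, h1⟩
    · exact ⟨n, by omega, not_le.mp h, hJ⟩

/-- There is a range `[P, L * P)` of difference counts that carries a large part of the additive
energy while smaller counts carry far less. -/
theorem exists_critical_scale {A : Finset Z} {V L N : ℝ} {J : ℕ} (hV : 0 < V) (hL : 1 ≤ L)
    (hM : (A.card : ℝ) < L ^ J) (hN : 2 ≤ N) (hE : V ≤ N * energyTwoMul 2 A) :
    ∃ P b : ℝ, 0 < P ∧ 0 < b ∧ 1 ≤ b * N ^ 5 ^ J ∧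
      ∑ x ∈ (A - A).filter (fun x => (diffCount A x : ℝ) < P), (diffCount A x : ℝ) ^ 2 * N ≤
        b ^ 4 * V ∧
      b / 2 * V ≤ ∑ x ∈ (A - A).filter (fun x => P ≤ (diffCount A x : ℝ) ∧
        (diffCount A x : ℝ) < L * P), (diffCount A x : ℝ) ^ 2 := by
  have hN0 : 0 < N := by linarith
  have hN1 : 1 ≤ N := by linarith
  set F : ℕ → ℝ := fun i => ∑ x ∈ (A - A).filter (fun x => (diffCount A x : ℝ) < L ^ i),
    (diffCount A x : ℝ) ^ 2 with hF
  have h0 : F 0 = 0 := by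
    refine sum_eq_zero fun x hx => ?_
    have h := (mem_filter.mp hx).2
    rw [pow_zero] at h
    have : diffCount A x = 0 := by
      have : diffCount A x < 1 := by exact_mod_cast h
      omega
    simp [this]
  have hFJ : F J = energyTwoMul 2 A := by
    rw [energyTwoMul_two_eq_sum, hF]
    simp only
    rw [filter_true_of_mem fun x _ =>
      lt_of_le_of_lt (Nat.cast_le.mpr (diffCount_le_card A x)) hM]
    push_cast
    rfl
  -- The threshold at step i is the fifth power of the reciprocal at step i + 1: the lower scales
  -- must be below the fourth power of the captured share b, with a factor N to spare.
  obtain ⟨i, hi, h1, h2⟩ := exists_jump (F := F) (a := fun i => (N ^ 5 ^ (J - i))⁻¹ * V) (J := J)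
    (by rw [h0]; positivity) (by
      rw [hFJ, Nat.sub_self, pow_zero, pow_one, inv_mul_le_iff₀ hN0]
      exact hE)
  obtain ⟨j, hj, hj'⟩ : ∃ j, J - i = j + 1 ∧ J - (i + 1) = j := ⟨J - (i + 1), by omega, rfl⟩
  rw [hj] at h1
  rw [hj'] at h2
  set b := (N ^ 5 ^ j)⁻¹ with hb
  have hb0 : 0 < b := by positivity
  have hbb : (N ^ 5 ^ (j + 1))⁻¹ * N ≤ b ^ 4 := by
    rw [hb, inv_pow, ← pow_mul, inv_mul_le_iff₀ (by positivity), ← div_eq_mul_inv,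
      le_div_iff₀ (by positivity), ← pow_succ']
    refine pow_le_pow_right₀ hN1 ?_
    have : 1 ≤ 5 ^ j := Nat.one_le_pow _ _ (by norm_num)
    rw [pow_succ]
    omega
  have hbhalf : (N ^ 5 ^ (j + 1))⁻¹ ≤ b / 2 := by
    have h3 : b ^ 4 ≤ b := by
      have hb1 : b ≤ 1 := inv_le_one_of_one_le₀ (one_le_pow₀ hN1)
      calc b ^ 4 ≤ b ^ 1 := pow_le_pow_of_le_one hb0.le hb1 (by norm_num)
        _ = b := pow_one b
    have h4 : (N ^ 5 ^ (j + 1))⁻¹ * 2 ≤ (N ^ 5 ^ (j + 1))⁻¹ * N := by gcongr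
    linarith
  refine ⟨L ^ i, b, by positivity, hb0, ?_, ?_, ?_⟩
  · rw [hb, inv_mul_eq_div, le_div_iff₀ (by positivity), one_mul]
    exact pow_le_pow_right₀ hN1 (Nat.pow_le_pow_right (by norm_num) (by omega))
  · rw [← sum_mul]
    calc F i * N ≤ (N ^ 5 ^ (j + 1))⁻¹ * V * N := by gcongr
      _ = (N ^ 5 ^ (j + 1))⁻¹ * N * V := by ring
      _ ≤ _ := by gcongr
  · have h3 : F (i + 1) = F i + ∑ x ∈ (A - A).filter (fun x => L ^ i ≤ (diffCount A x : ℝ) ∧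
        (diffCount A x : ℝ) < L * L ^ i), (diffCount A x : ℝ) ^ 2 := by
      simp only [hF]
      rw [← sum_filter_add_sum_filter_not ((A - A).filter fun x => (diffCount A x : ℝ) < L ^ (i + 1))
        (fun x => (diffCount A x : ℝ) < L ^ i), filter_filter, filter_filter]
      congr 2
      · refine filter_congr fun x _ => ⟨fun h => h.2, fun h => ⟨h.trans_le ?_, h⟩⟩
        exact pow_le_pow_right₀ hL (by omega)
      · refine filter_congr fun x _ => ?_
        rw [not_lt, pow_succ', and_comm]
    have h4 : (N ^ 5 ^ (j + 1))⁻¹ * V ≤ b / 2 * V := by gcongr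
    have h5 : b * V = b / 2 * V + b / 2 * V := by ring
    linarith

/-- The structure theorem with an explicit loss parameter `L`. -/
theorem exists_isCoverUpTo_of_energy {A : Finset Z} {K s T L N : ℝ} {J : ℕ} (hA : A.Nonempty)
    (hK : 1 ≤ K) (hT : 0 < T) (hL : 2 ≤ L) (hJ : 0 < J) (hJL : (J : ℝ) ≤ L)
    (hM : (A.card : ℝ) < L ^ J) (hN2 : 2 ≤ N) (hKN : K ≤ N) (hN : 144 * K ^ 2 * s ≤ N) (hs : 0 ≤ s)
    (hNL : 2 * N ^ 5 ^ J ≤ L) (hE2 : A.card * T ≤ K * energyTwoMul 2 A)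
    (hE2' : energyTwoMul 2 A ≤ K * (A.card * T))
    (hE4 : energyTwoMul 4 A ≤ K * s * (A.card * T ^ 3))
    (hW : ∀ a ∈ A, (quadruplesThrough A a : ℝ) ≤ K * T) :
    ∃ C ⊆ A, C.Nonempty ∧ ∃ H X : Finset Z, IsCoverUpTo A H X T C.card ((L ^ 149) ^ 77) := by
  have hMpos : (0 : ℝ) < A.card := by exact_mod_cast hA.card_pos
  have hL0 : 0 < L := by linarith
  have hL1 : 1 ≤ L := by linarith
  have hNL' : N ≤ L := by
    have h1 : N ≤ N ^ 5 ^ J := le_self_pow₀ (by linarith) (by positivity)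
    have h2 : 0 ≤ N ^ 5 ^ J := by positivity
    linarith
  have hKL : K ≤ L := hKN.trans hNL'
  obtain ⟨P, b, hP, hb, hbN, hlow, hE⟩ := exists_critical_scale (A := A) (V := A.card * T)
    (by positivity) hL1 hM hN2 (hE2.trans (by gcongr))
  set D := (A - A).filter (fun x => P ≤ (diffCount A x : ℝ) ∧ (diffCount A x : ℝ) < L * P) with hD
  set E := ∑ x ∈ D, (diffCount A x : ℝ) ^ 2 with hEdef
  rw [← sum_mul] at hlow
  set El := ∑ x ∈ (A - A).filter (fun x => (diffCount A x : ℝ) < P), (diffCount A x : ℝ) ^ 2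
    with hEl
  have hEl0 : 0 ≤ El := sum_nonneg fun _ _ => by positivity
  have hEpos : 0 < E := lt_of_lt_of_le (by positivity) hE
  have hEL : A.card * T ≤ L * E := by
    have h1 : 1 ≤ L * (b / 2) := by
      calc 1 ≤ b * N ^ 5 ^ J := hbN
        _ = 2 * N ^ 5 ^ J * (b / 2) := by ring
        _ ≤ L * (b / 2) := by gcongr
    calc A.card * T ≤ (L * (b / 2)) * (A.card * T) := le_mul_of_one_le_left (by positivity) h1
      _ = L * (b / 2 * (A.card * T)) := by ring
      _ ≤ L * E := by gcongr
  -- The constant 144 is 9·16, the 16 coming from (b/2)^4.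
  have hlow' : 9 * energyTwoMul 4 A * (A.card : ℝ) ^ 2 * El ≤ E ^ 4 := by
    have h1 : K * s ≤ K ^ 2 * s := by
      gcongr
      exact le_self_pow₀ hK (by norm_num)
    calc 9 * energyTwoMul 4 A * (A.card : ℝ) ^ 2 * El
        ≤ 9 * (K * s * (A.card * T ^ 3)) * (A.card : ℝ) ^ 2 * El := by gcongr
      _ = (144 * (K * s)) * El * (A.card * T) ^ 3 / 16 := by ring
      _ ≤ N * El * (A.card * T) ^ 3 / 16 := by
        gcongr
        linarith
      _ = (El * N) * (A.card * T) ^ 3 / 16 := by ring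
      _ ≤ (b ^ 4 * (A.card * T)) * (A.card * T) ^ 3 / 16 := by gcongr
      _ = (b / 2 * (A.card * T)) ^ 4 := by ring
      _ ≤ E ^ 4 := by gcongr
  -- η = L^(-3) works because 9K²s ≤ L² and (mT)^4 ≤ L^4 E^4, a total of L^6 = η^(-2).
  have hη : 9 * energyTwoMul 4 A * (A.card : ℝ) ^ 2 * (((L ^ 3)⁻¹) ^ 2 * energyTwoMul 2 A) ≤
      E ^ 4 := by
    have h1 : 9 * K ^ 2 * s ≤ L ^ 2 := by
      have : 0 ≤ K ^ 2 * s := by positivity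
      nlinarith
    have h2 : (A.card * T) ^ 4 ≤ L ^ 4 * E ^ 4 := by
      rw [← mul_pow]
      gcongr
    calc 9 * energyTwoMul 4 A * (A.card : ℝ) ^ 2 * (((L ^ 3)⁻¹) ^ 2 * energyTwoMul 2 A)
        ≤ 9 * (K * s * (A.card * T ^ 3)) * (A.card : ℝ) ^ 2 *
          (((L ^ 3)⁻¹) ^ 2 * (K * (A.card * T))) := by gcongr
      _ = (9 * K ^ 2 * s) * (A.card * T) ^ 4 * ((L ^ 3)⁻¹) ^ 2 := by ring
      _ ≤ L ^ 2 * (L ^ 4 * E ^ 4) * ((L ^ 3)⁻¹) ^ 2 := by gcongr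
      _ = E ^ 4 := by field_simp
  obtain ⟨S, Y, G, hG, hYA, hGA, hEG, hSY⟩ := exists_graph_of_energy (η := (L ^ 3)⁻¹) hP
    (by positivity) hL0 D (fun d hd => (mem_filter.mp hd).2.1) (fun d hd => (mem_filter.mp hd).2.2)
    hEpos hlow' hη hW
  rw [← hEdef] at hEG
  have hTG : T ≤ L ^ 5 * G.card := by
    have h1 : A.card * T ≤ A.card * (L ^ 5 * G.card) := by
      calc A.card * T ≤ L * E := hEL
        _ ≤ L * (3 * A.card * L ^ 2 * G.card) := by gcongr
        _ = 3 * (A.card * L ^ 3 * G.card) := by ring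
        _ ≤ L ^ 2 * (A.card * L ^ 3 * G.card) := by gcongr; nlinarith
        _ = _ := by ring
    exact le_of_mul_le_mul_left h1 hMpos
  have hGpos : (0 : ℝ) < G.card := by
    by_contra h
    have h5 : (G.card : ℝ) = 0 := le_antisymm (not_lt.mp h) (Nat.cast_nonneg _)
    rw [h5, mul_zero] at hTG
    linarith
  have hGne : G.Nonempty := by
    rw [← card_pos]
    exact_mod_cast hGpos
  have hdense : (S.card : ℝ) * Y.card ≤ L ^ 12 * G.card := by
    calc (S.card : ℝ) * Y.card = L ^ 3 * (S.card * Y.card * (L ^ 3)⁻¹) := by field_simp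
      _ ≤ L ^ 3 * (L ^ 2 * (K * T)) := by gcongr
      _ ≤ L ^ 3 * (L ^ 2 * (L * (L ^ 5 * G.card))) := by gcongr
      _ = L ^ 11 * G.card := by ring
      _ ≤ L ^ 12 * G.card := by
        gcongr
        norm_num
  have hWG : K * T ≤ L ^ 7 * G.card := by
    calc K * T ≤ L * (L ^ 5 * G.card) := by gcongr
      _ = L ^ 6 * G.card := by ring
      _ ≤ L ^ 7 * G.card := by
        gcongr
        norm_num
  obtain ⟨C, hCA, B, hC, hB, hCB, hGCB⟩ := exists_almost_periods_of_graph hG hGne hGA hL hJ hJL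
    (lt_of_le_of_lt (Nat.cast_le.mpr (card_le_card hYA)) hM) hdense hWG hW
  have hLL : L ^ 5 ≤ L ^ 149 := pow_le_pow_right₀ hL1 (by norm_num)
  have h32 : 32 ≤ L ^ 149 := by
    refine le_trans ?_ hLL
    calc (32 : ℝ) = 2 ^ 5 := by norm_num
      _ ≤ L ^ 5 := by gcongr
  refine ⟨C, hCA, hC, isCoverUpTo_of_almost_periods hCA hC hB h32 hT ?_ hW ?_ ?_⟩
  · have h1 : K ≤ L ^ 149 := hKL.trans (le_self_pow₀ hL1 (by norm_num))
    have h4 : 4 ≤ L ^ 149 := by linarith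
    generalize L ^ 149 = Λ at *
    calc 4 * (K * T) ^ 2 = 4 * K ^ 2 * T ^ 2 := by ring
      _ ≤ Λ * Λ ^ 2 * T ^ 2 := by gcongr
      _ = _ := by ring
  · intro z hz
    refine le_trans ?_ (hCB z hz)
    gcongr ?_⁻¹ * _
    exact pow_le_pow_right₀ hL1 (by norm_num)
  · calc T ≤ L ^ 5 * G.card := hTG
      _ ≤ L ^ 5 * (L ^ 144 * (B.card * C.card)) := by gcongr
      _ = _ := by ring

/-! ### Exponents and the loss function. -/

/-- The conclusion of the structure theorem for the set `A`, with constant `C` and exponent loss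
`ε`. -/
def HasStructure (A : Finset Z) (τ C ε : ℝ) : Prop :=
  ∃ (α : ℝ) (H X : Finset Z), 0 ≤ α ∧ -H = H ∧ -X = X ∧
    (H.card : ℝ) ≤ C * (A.card : ℝ) ^ (τ + α + ε) ∧
    (X.card : ℝ) ≤ C * (A.card : ℝ) ^ (1 - τ - 2 * α + ε) ∧
    ((H - H).card : ℝ) ≤ C * (H.card : ℝ) ^ (1 + ε) ∧
    C⁻¹ * (A.card : ℝ) ^ (1 - α - ε) ≤ (((X + H) ∩ A).card : ℝ)

/-- The set `A` is additively nonsmoothing: its eightfold energy is nearly as small as its additive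
energy permits. -/
structure IsNonsmoothing (A : Finset Z) (τ σ K : ℝ) : Prop where
  neg_eq : -A = A
  le_energy : K⁻¹ * (A.card : ℝ) ^ (2 + τ) ≤ energyTwoMul 2 A
  energy_le : energyTwoMul 2 A ≤ K * (A.card : ℝ) ^ (2 + τ)
  energy_four_le : energyTwoMul 4 A ≤ K * (A.card : ℝ) ^ (4 + 3 * τ + σ)
  quadruples_le : ∀ a ∈ A, (quadruplesThrough A a : ℝ) ≤ K * (A.card : ℝ) ^ (1 + τ)

/-- Sets that are nonsmoothing with exponent `σ` have structure with exponent loss `ε`. -/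
def StructureBound (τ ε σ : ℝ) : Prop :=
  ∀ K : ℝ, 0 < K → ∃ C : ℝ, 0 < C ∧ ∀ (Z : Type u) [AddCommGroup Z] [DecidableEq Z]
    (A : Finset Z), IsNonsmoothing A τ σ K → HasStructure A τ C ε

theorem hasStructure_empty {τ C ε : ℝ} (hC : 0 < C) (hε : 0 < ε) :
    HasStructure (∅ : Finset Z) τ C ε := by
  -- Taking α = 1 makes the last exponent -ε, which is nonzero, so the power of 0 is 0; with α = 0
  -- and ε = 1 it would be 0^0 = 1.
  refine ⟨1, ∅, ∅, zero_le_one, by simp, by simp, ?_, ?_, ?_, ?_⟩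
  · simp only [card_empty, Nat.cast_zero]; positivity
  · simp only [card_empty, Nat.cast_zero]; positivity
  · simp only [sub_empty, card_empty, Nat.cast_zero]; positivity
  · simp only [card_empty, Nat.cast_zero]
    rw [Real.zero_rpow (by linarith)]
    simp

/-- A loss this large is met trivially by H = {0} and X = A, so admissible losses exist for every σ.
-/
theorem structureBound_large {τ : ℝ} (hτ : 0 < τ) (σ : ℝ) :
    StructureBound.{u} τ (1 + τ) σ := by
  intro K _
  refine ⟨1, one_pos, fun Z _ _ A hA => ?_⟩
  obtain rfl | hne := A.eq_empty_or_nonempty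
  · exact hasStructure_empty one_pos (by linarith)
  have hM : (1 : ℝ) ≤ A.card := by exact_mod_cast hne.card_pos
  refine ⟨0, {0}, A, le_rfl, by simp, hA.neg_eq, ?_, ?_, by simp, ?_⟩
  · simpa using Real.one_le_rpow hM (by linarith)
  · rw [one_mul]
    nth_rw 1 [← Real.rpow_one (A.card : ℝ)]
    exact Real.rpow_le_rpow_of_exponent_le hM (by linarith)
  · simp only [singleton_zero, add_zero, inter_self, inv_one, one_mul]
    nth_rw 2 [← Real.rpow_one (A.card : ℝ)]
    exact Real.rpow_le_rpow_of_exponent_le hM (by linarith)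

theorem exists_rpow_one_sub_eq {m c : ℝ} (hc : 1 ≤ c) (hcm : c ≤ m) :
    ∃ α : ℝ, 0 ≤ α ∧ m ^ (1 - α) = c := by
  obtain rfl | hm := (hc.trans hcm).eq_or_lt
  · exact ⟨0, le_rfl, by rw [Real.one_rpow]; exact le_antisymm hc hcm⟩
  · refine ⟨1 - Real.logb m c, ?_, ?_⟩
    · rw [sub_nonneg, Real.logb_le_iff_le_rpow hm (by linarith), Real.rpow_one]
      exact hcm
    · rw [sub_sub_cancel, Real.rpow_logb (by linarith) hm.ne' (by linarith)]

/-- The number α is defined by c = m^(1-α). For the doubling bound, c ≤ m forces |H| ≥ m^(τ-e)/c₁,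
and e ≤ (τ - e)ε then lets the loss m^e be absorbed into c₁^ε |H|^ε. -/
theorem IsCoverUpTo.hasStructure {A H X : Finset Z} {τ ε e c c₁ : ℝ} (hc : 1 ≤ c)
    (hcA : c ≤ A.card) (hc₁ : 1 ≤ c₁) (hε : 0 ≤ ε) (heε : e ≤ ε) (he : e ≤ (τ - e) * ε)
    (h : IsCoverUpTo A H X ((A.card : ℝ) ^ (1 + τ)) c (c₁ * (A.card : ℝ) ^ e)) :
    HasStructure A τ (c₁ ^ (1 + ε)) ε := by
  have hm : (1 : ℝ) ≤ A.card := hc.trans hcA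
  obtain ⟨hH, hX, h1, h2, h3, h4, h5⟩ := h
  unfold HasStructure
  generalize (A.card : ℝ) = m at *
  have hm0 : 0 < m := by linarith
  have hc₁0 : 0 < c₁ := by linarith
  obtain ⟨α, hα, rfl⟩ := exists_rpow_one_sub_eq hc hcA
  have hc₁C : c₁ ≤ c₁ ^ (1 + ε) := by
    nth_rw 1 [← Real.rpow_one c₁]
    exact Real.rpow_le_rpow_of_exponent_le hc₁ (by linarith)
  have hCpos : 0 < c₁ ^ (1 + ε) := by positivity
  refine ⟨α, H, X, hα, hH, hX, ?_, ?_, ?_, ?_⟩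
  · have h6 : m ^ (1 - α) * H.card ≤ m ^ (1 - α) * (c₁ * m ^ (τ + α + e)) := by
      calc m ^ (1 - α) * H.card = H.card * m ^ (1 - α) := mul_comm _ _
        _ ≤ c₁ * m ^ e * m ^ (1 + τ) := h2
        _ = c₁ * m ^ (e + (1 + τ)) := by rw [Real.rpow_add hm0 e]; ring
        _ = c₁ * m ^ ((1 - α) + (τ + α + e)) := by congr 2; ring
        _ = _ := by rw [Real.rpow_add hm0]; ring
    calc (H.card : ℝ) ≤ c₁ * m ^ (τ + α + e) := le_of_mul_le_mul_left h6 (by positivity)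
      _ ≤ _ := by gcongr
  · have h6 : m ^ (1 + τ) * X.card ≤ m ^ (1 + τ) * (c₁ * m ^ (1 - τ - 2 * α + e)) := by
      calc m ^ (1 + τ) * X.card = X.card * m ^ (1 + τ) := mul_comm _ _
        _ ≤ c₁ * m ^ e * (m ^ (1 - α)) ^ 2 := h3
        _ = c₁ * m ^ (e + ((1 - α) + (1 - α))) := by
            rw [Real.rpow_add hm0, Real.rpow_add hm0]; ring
        _ = c₁ * m ^ ((1 + τ) + (1 - τ - 2 * α + e)) := by congr 2; ring
        _ = _ := by rw [Real.rpow_add hm0]; ring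
    calc (X.card : ℝ) ≤ c₁ * m ^ (1 - τ - 2 * α + e) := le_of_mul_le_mul_left h6 (by positivity)
      _ ≤ _ := by gcongr
  · have h6 : m ^ (τ - e) ≤ c₁ * H.card := by
      have h7 : m ^ (1 + e) * m ^ (τ - e) ≤ m ^ (1 + e) * (c₁ * H.card) := by
        calc m ^ (1 + e) * m ^ (τ - e) = m ^ (1 + τ) := by
              rw [← Real.rpow_add hm0]; ring_nf
          _ ≤ c₁ * m ^ e * (m ^ (1 - α) * H.card) := h1
          _ ≤ c₁ * m ^ e * (m * H.card) := by gcongr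
          _ = _ := by rw [Real.rpow_add hm0, Real.rpow_one]; ring
      exact le_of_mul_le_mul_left h7 (by positivity)
    have hHpos : (0 : ℝ) < H.card := by
      have : 0 < m ^ (τ - e) := by positivity
      by_contra h0
      have h5 : (H.card : ℝ) = 0 := le_antisymm (not_lt.mp h0) (Nat.cast_nonneg _)
      rw [h5, mul_zero] at h6
      linarith
    have h8 : m ^ e ≤ c₁ ^ ε * (H.card : ℝ) ^ ε := by
      calc m ^ e ≤ m ^ ((τ - e) * ε) := by gcongr
        _ = (m ^ (τ - e)) ^ ε := Real.rpow_mul hm0.le _ _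
        _ ≤ (c₁ * H.card) ^ ε := by gcongr
        _ = _ := Real.mul_rpow hc₁0.le hHpos.le
    calc ((H - H).card : ℝ) ≤ c₁ * m ^ e * H.card := h4
      _ ≤ c₁ * (c₁ ^ ε * (H.card : ℝ) ^ ε) * H.card := by gcongr
      _ = _ := by
        rw [Real.rpow_add hc₁0, Real.rpow_add hHpos, Real.rpow_one, Real.rpow_one]; ring
  · rw [inv_mul_le_iff₀ hCpos]
    calc m ^ (1 - α - ε) = m ^ (1 - α) * m ^ (-ε) := by rw [← Real.rpow_add hm0]; congr 1
      _ ≤ c₁ * m ^ e * ((X + H) ∩ A).card * m ^ (-ε) := by gcongr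
      _ = c₁ * ((X + H) ∩ A).card * m ^ (e + -ε) := by rw [Real.rpow_add hm0]; ring
      _ ≤ c₁ ^ (1 + ε) * ((X + H) ∩ A).card * 1 := by
        gcongr
        exact Real.rpow_le_one_of_one_le_of_nonpos hm (by linarith)
      _ = _ := mul_one _

theorem IsNonsmoothing.exists_isCoverUpTo {A : Finset Z} {τ σ σ₁ δ K₀ K c₀ : ℝ} {J F : ℕ}
    (hA : IsNonsmoothing A τ σ K₀) (hne : A.Nonempty) (hK₀ : 0 < K₀) (hK₀K : K₀ ≤ K) (hK1 : 1 ≤ K)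
    (hδ0 : 0 < δ) (hJ0 : 0 < J) (hJδ : 1 ≤ δ * J) (hF : F = 5 ^ J) (hσ₁0 : 0 < σ₁)
    (hσ₁ : σ₁ * F = δ) (hσ : σ ≤ σ₁) (hc₀ : c₀ = 2 * (144 * K ^ 2) ^ F + J) :
    ∃ C ⊆ A, C.Nonempty ∧ ∃ H X : Finset Z, IsCoverUpTo A H X ((A.card : ℝ) ^ (1 + τ)) C.card
      (((c₀ * (A.card : ℝ) ^ δ) ^ 149) ^ 77) := by
  have hKpow : 1 ≤ (144 * K ^ 2) ^ F := one_le_pow₀ (by nlinarith)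
  have hJr : (0 : ℝ) ≤ J := Nat.cast_nonneg _
  have hc₀2 : 2 ≤ c₀ := by linarith
  have hm : (1 : ℝ) ≤ A.card := by exact_mod_cast hne.card_pos
  obtain ⟨-, hE, hE', hE4, hW⟩ := hA
  obtain ⟨m, hmdef⟩ : ∃ m : ℝ, m = (A.card : ℝ) := ⟨_, rfl⟩
  rw [← hmdef] at hm hE hE' hE4 hW ⊢
  have hm0 : 0 < m := by linarith
  have hmδ : 1 ≤ m ^ δ := Real.one_le_rpow hm hδ0.le
  have hs1 : 1 ≤ m ^ σ₁ := Real.one_le_rpow hm hσ₁0.le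
  have hL2 : 2 ≤ c₀ * m ^ δ := by nlinarith
  have e2 : m ^ (2 + τ) = m * m ^ (1 + τ) := by
    rw [show 2 + τ = 1 + (1 + τ) by ring, Real.rpow_add hm0, Real.rpow_one]
  have e4 : m ^ (4 + 3 * τ + σ₁) = m ^ σ₁ * (m * (m ^ (1 + τ)) ^ 3) := by
    rw [show 4 + 3 * τ + σ₁ = σ₁ + (1 + ((1 + τ) + (1 + τ) + (1 + τ))) by ring,
      Real.rpow_add hm0, Real.rpow_add hm0, Real.rpow_add hm0, Real.rpow_add hm0, Real.rpow_one]
    ring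
  have hN144 : 144 * K ^ 2 ≤ 144 * K ^ 2 * m ^ σ₁ := le_mul_of_one_le_right (by positivity) hs1
  have hpow : (m ^ σ₁) ^ F = m ^ δ := by
    rw [← Real.rpow_natCast, ← Real.rpow_mul hm0.le, hσ₁]
  have hM : m < (c₀ * m ^ δ) ^ J := by
    calc m = m ^ (1 : ℝ) := (Real.rpow_one m).symm
      _ ≤ m ^ (δ * J) := by gcongr
      _ = (m ^ δ) ^ J := by rw [Real.rpow_mul hm0.le, Real.rpow_natCast]
      _ < (c₀ * m ^ δ) ^ J := by
        gcongr
        nlinarith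
  have hNL : 2 * (144 * K ^ 2 * m ^ σ₁) ^ 5 ^ J ≤ c₀ * m ^ δ := by
    rw [← hF, mul_pow, hpow, ← mul_assoc]
    gcongr
    linarith
  have hE2 : m * m ^ (1 + τ) ≤ K * energyTwoMul 2 A := by
    rw [← e2]
    rw [inv_mul_le_iff₀ hK₀] at hE
    exact hE.trans (by gcongr)
  have hE2' : energyTwoMul 2 A ≤ K * (m * m ^ (1 + τ)) := by
    rw [← e2]
    exact hE'.trans (by gcongr)
  have hE8 : energyTwoMul 4 A ≤ K * m ^ σ₁ * (m * (m ^ (1 + τ)) ^ 3) := by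
    rw [mul_assoc, ← e4]
    refine hE4.trans ?_
    gcongr
  have hW' : ∀ a ∈ A, (quadruplesThrough A a : ℝ) ≤ K * m ^ (1 + τ) :=
    fun a ha => (hW a ha).trans (by gcongr)
  have hJL : (J : ℝ) ≤ c₀ * m ^ δ := by nlinarith
  have h2N : 2 ≤ 144 * K ^ 2 * m ^ σ₁ := by nlinarith
  have hKN : K ≤ 144 * K ^ 2 * m ^ σ₁ := by nlinarith
  rw [hmdef] at *
  exact exists_isCoverUpTo_of_energy hne hK1 (by positivity) hL2 hJ0 hJL hM h2N hKN le_rfl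
    (by positivity) hNL hE2 hE2' hE8 hW'

/-- The parameter e meets the conditions of `IsCoverUpTo.hasStructure`, and δ undoes the powers 149
and 77. Taking J ≥ 1/δ makes L^J exceed m for L = c₀ m^δ, and σ₁ = δ/5^J keeps N^(5^J), with N a
constant times m^σ₁, within L. None of δ, J, σ₁ depends on K. -/
theorem structureBound_small {τ ε : ℝ} (hτ : 0 < τ) (hε : 0 < ε) :
    ∃ σ₁ : ℝ, 0 < σ₁ ∧ ∀ σ : ℝ, σ ≤ σ₁ → StructureBound.{u} τ ε σ := by
  obtain ⟨e, he⟩ : ∃ e : ℝ, e = ε * τ / (1 + ε + τ) := ⟨_, rfl⟩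
  have he0 : 0 < e := he ▸ by positivity
  have heε : e ≤ ε := by
    rw [he, div_le_iff₀ (by positivity)]
    nlinarith [mul_pos hε hε]
  have heτ : e ≤ (τ - e) * ε := by
    have h1 : e * (1 + ε + τ) = ε * τ := by rw [he]; field_simp
    nlinarith [mul_pos he0 hτ]
  obtain ⟨δ, hδ⟩ : ∃ δ : ℝ, δ = e / 149 / 77 := ⟨_, rfl⟩
  have hδ0 : 0 < δ := hδ ▸ by positivity
  obtain ⟨J, hJ⟩ := exists_nat_ge (1 / δ)
  have hJδ : 1 ≤ δ * J := by
    rw [div_le_iff₀ hδ0] at hJ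
    linarith
  have hJ0 : 0 < J := by
    have : (0 : ℝ) < J := lt_of_lt_of_le (by positivity) hJ
    exact_mod_cast this
  obtain ⟨F, hF⟩ : ∃ F : ℕ, F = 5 ^ J := ⟨_, rfl⟩
  have hF0 : 0 < F := hF ▸ pow_pos (by norm_num) J
  have h5J : (0 : ℝ) < F := by exact_mod_cast hF0
  refine ⟨δ / F, div_pos hδ0 h5J, fun σ hσ K₀ hK₀ => ?_⟩
  obtain ⟨K, hK₀K, hK1⟩ : ∃ K : ℝ, K₀ ≤ K ∧ 1 ≤ K := ⟨max K₀ 1, le_max_left _ _, le_max_right _ _⟩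
  obtain ⟨c₀, hc₀⟩ : ∃ c₀ : ℝ, c₀ = 2 * (144 * K ^ 2) ^ F + J := ⟨_, rfl⟩
  have hKpow : 1 ≤ (144 * K ^ 2) ^ F := one_le_pow₀ (by nlinarith)
  have hJr : (0 : ℝ) ≤ J := Nat.cast_nonneg _
  have hc₀1 : 1 ≤ c₀ := by linarith
  have hc₁ : 1 ≤ (c₀ ^ 149) ^ 77 := one_le_pow₀ (one_le_pow₀ hc₀1)
  have hC : 0 < ((c₀ ^ 149) ^ 77) ^ (1 + ε) := Real.rpow_pos_of_pos (by linarith) _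
  refine ⟨((c₀ ^ 149) ^ 77) ^ (1 + ε), hC, fun Z _ _ A hA => ?_⟩
  obtain rfl | hne := A.eq_empty_or_nonempty
  · exact hasStructure_empty hC hε
  obtain ⟨C, hCA, hCne, H, X, hHX⟩ := hA.exists_isCoverUpTo hne hK₀ hK₀K hK1 hδ0 hJ0 hJδ hF
    (div_pos hδ0 h5J) (div_mul_cancel₀ _ h5J.ne') hσ hc₀
  have hm0 : (0 : ℝ) ≤ A.card := Nat.cast_nonneg _
  have e5 : ((c₀ * (A.card : ℝ) ^ δ) ^ 149) ^ 77 = (c₀ ^ 149) ^ 77 * (A.card : ℝ) ^ e := by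
    have : (((A.card : ℝ) ^ δ) ^ 149) ^ 77 = (A.card : ℝ) ^ e := by
      rw [← Real.rpow_mul_natCast hm0, ← Real.rpow_mul_natCast hm0, hδ]
      congr 1
      push_cast
      ring
    rw [mul_pow, mul_pow, this]
  rw [e5] at hHX
  exact hHX.hasStructure (by exact_mod_cast hCne.card_pos) (by exact_mod_cast card_le_card hCA)
    hc₁ hε.le heε heτ

/-- The exponent losses can be chosen as a function of `σ` tending to zero. -/
theorem exists_loss_function {τ : ℝ} (hτ : 0 < τ) :
    ∃ f : ℝ → ℝ, (∀ η ∈ Set.Ioo (0 : ℝ) 1, 0 < f η) ∧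
      Filter.Tendsto f (nhdsWithin 0 (Set.Ioi 0)) (nhds 0) ∧
      ∀ σ ∈ Set.Ioo (0 : ℝ) 1, StructureBound.{u} τ (f σ) σ := by
  set S : ℝ → Set ℝ := fun σ => {ε | 0 < ε ∧ StructureBound.{u} τ ε σ} with hS
  have hne : ∀ σ, (S σ).Nonempty := fun σ => ⟨1 + τ, by linarith, structureBound_large hτ σ⟩
  have hbdd : ∀ σ, BddBelow (S σ) := fun σ => ⟨0, fun ε hε => hε.1.le⟩
  -- The infimum of the admissible losses need not be admissible; the slack σ allows a choice near
  -- it and itself tends to 0.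
  have hex : ∀ σ : ℝ, ∃ ε ∈ S σ, 0 < σ → ε < sInf (S σ) + σ := by
    intro σ
    by_cases hσ : 0 < σ
    · obtain ⟨ε, h1, h2⟩ := exists_lt_of_csInf_lt (hne σ) (lt_add_of_pos_right (sInf (S σ)) hσ)
      exact ⟨ε, h1, fun _ => h2⟩
    · obtain ⟨ε, h⟩ := hne σ
      exact ⟨ε, h, fun h => absurd h hσ⟩
  choose f hf hf' using hex
  refine ⟨f, fun η _ => (hf η).1, ?_, fun σ _ => (hf σ).2⟩
  rw [Metric.tendsto_nhdsWithin_nhds]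
  intro ε hε
  obtain ⟨σ₁, hσ₁, h⟩ := structureBound_small.{u} hτ (half_pos hε)
  refine ⟨min σ₁ (ε / 2), lt_min hσ₁ (half_pos hε), fun {x} hx hd => ?_⟩
  rw [Real.dist_eq, sub_zero, abs_of_pos hx, lt_min_iff] at hd
  rw [Real.dist_eq, sub_zero, abs_of_pos (hf x).1]
  have h1 : sInf (S x) ≤ ε / 2 := csInf_le (hbdd x) ⟨half_pos hε, h x hd.1.le⟩
  have := hf' x hx
  linarith

end

theorem theorem3p1 (τ₀ : ℝ) (hτ₀ : 0 < τ₀) :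
    ∃ f : ℝ → ℝ, (∀ η ∈ Set.Ioo (0 : ℝ) 1, 0 < f η) ∧
      Filter.Tendsto f (nhdsWithin 0 (Set.Ioi 0)) (nhds 0) ∧
      ∀ (K σ₀ : ℝ), 0 < K → σ₀ ∈ Set.Ioo (0 : ℝ) 1 →
        ∃ C : ℝ, 0 < C ∧
          ∀ (Z : Type u) [AddCommGroup Z] [DecidableEq Z] (Δ : Finset Z) (M : ℕ),
            -Δ = Δ → Δ.card = M →
            K⁻¹ * (M : ℝ) ^ (2 + τ₀) ≤ (energyTwoMul 2 Δ : ℝ) →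
            (energyTwoMul 2 Δ : ℝ) ≤ K * (M : ℝ) ^ (2 + τ₀) →
            (energyTwoMul 4 Δ : ℝ) ≤ K * (M : ℝ) ^ (4 + 3 * τ₀ + σ₀) →
            (∀ a ∈ Δ, (quadruplesThrough Δ a : ℝ) ≤ K * (M : ℝ) ^ (1 + τ₀)) →
            ∃ (α : ℝ) (H X : Finset Z), 0 ≤ α ∧ -H = H ∧ -X = X ∧
              (H.card : ℝ) ≤ C * (M : ℝ) ^ (τ₀ + α + f σ₀) ∧
              (X.card : ℝ) ≤ C * (M : ℝ) ^ (1 - τ₀ - 2 * α + f σ₀) ∧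
              ((H - H).card : ℝ) ≤ C * (H.card : ℝ) ^ (1 + f σ₀) ∧
              C⁻¹ * (M : ℝ) ^ (1 - α - f σ₀) ≤ (((X + H) ∩ Δ).card : ℝ) := by
  obtain ⟨f, hf, hf0, h⟩ := exists_loss_function.{u} hτ₀
  refine ⟨f, hf, hf0, fun K σ₀ hK hσ₀ => ?_⟩
  obtain ⟨C, hC, hA⟩ := h σ₀ hσ₀ K hK
  refine ⟨C, hC, fun Z _ _ Δ M hneg hM h1 h2 h3 h4 => ?_⟩
  subst hM
  exact hA Z Δ ⟨hneg, h1, h2, h3, h4⟩
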